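/- A super-ring is a ring with unit $A=A_0\oplus A_1$ graded by $\mathbb Z/2$; it is assumed super-commutative: even elements are central and $a^2=0$ for every $a\in A_1$. A super-ideal is a homogeneous ideal; $A$ is Noetherian if its super-ideals satisfy the ascending chain condition. A super-ideal $\mathfrak p$ is prime (maximal) if $A/\mathfrak p$ is an integral domain (a field), and $A_{\mathfrak p}=(A_0\setminus\mathfrak p_0)^{-1}A$, where $\mathfrak p_0=\mathfrak p\cap A_0$. A super-ring is local if it has a unique maximal super-ideal. For a Noetherian super-ring $R$ with $\operatorname{Kdim}(R_0)<\infty$, elements $y_1,\dots,y_s\in R_1$ form a system of odd parameters if $\operatorname{Kdim}(R_0)=\operatorname{Kdim}\bigl(R_0/\operatorname{Ann}_{R_0}(y_1\cdots y_s)\bigr)$. The Krull super-dimension of $R$ is $\operatorname{Ksdim}(R)=r\mid s$, where $r=\operatorname{Kdim}(R_0)$ and $s$ is the largest length of a system of odd parameters. A Noetherian local super-ring $R$ with maximal super-ideal $\mathfrak m$ and residue field $K=R/\mathfrak m$ is regular if $\operatorname{Ksdim}(R)=\dim_K(\mathfrak m/\mathfrak m^2)_0\mid\dim_K(\mathfrak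 m/\mathfrak m^2)_1$. A Noetherian super-ring $A$ is regular if the local super-ring $A_{\mathfrak p}$ is regular for every prime super-ideal $\mathfrak p$ of $A$. Let $I_A=AA_1$ and $\overline A=A/I_A$ (a commutative ring), let $\operatorname{gr}_{I_A}(A)=\bigoplus_{n\ge 0}I_A^n/I_A^{n+1}$, a graded $\overline A$-algebra, and let $$\lambda_A:\wedge_{\overline A}(I_A/I_A^2)\to\operatorname{gr}_{I_A}(A)$$ be the $\overline A$-algebra map induced by the embedding $I_A/I_A^2\to\operatorname{gr}_{I_A}(A)$. **Proposition.** For a Noetherian super-ring $A$ the following are equivalent: (a) $A$ is regular; (b) (i) the ring $\overline A$ is regular, (ii) the $\overline A$-module $I_A/I_A^2$ is projective, and (iii) $\lambda_A$ is an isomorphism. -/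

import Mathlib

universe u

/-! ## Super-commutative super-rings

A super-ring is a ring `A` with a grading `𝒜 : ZMod 2 → AddSubgroup A` and `[GradedRing 𝒜]`. -/

/-- Super-commutativity: even elements commute with all homogeneous elements, and odd elements
have square zero. -/
class SuperCommutative {A : Type u} [Ring A] (𝒜 : ZMod 2 → AddSubgroup A) : Prop where
  even_mul_comm : ∀ r ∈ 𝒜 0, ∀ i : ZMod 2, ∀ s ∈ 𝒜 i, r * s = s * r
  odd_mul_self : ∀ s ∈ 𝒜 1, s * s = 0

namespace SuperRing

section Basic

theorem odd_anticomm {A : Type u} [Ring A] (𝒜 : ZMod 2 → AddSubgroup A)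
    [SuperCommutative 𝒜] {x y : A} (hx : x ∈ 𝒜 1) (hy : y ∈ 𝒜 1) : x * y = -(y * x) := by
  have h := SuperCommutative.odd_mul_self (𝒜 := 𝒜) (x + y) (add_mem hx hy)
  have h1 := SuperCommutative.odd_mul_self (𝒜 := 𝒜) x hx
  have h2 := SuperCommutative.odd_mul_self (𝒜 := 𝒜) y hy
  rw [mul_add, add_mul, add_mul, h1, h2, zero_add, add_zero] at h
  exact eq_neg_of_add_eq_zero_right h

variable {A : Type u} [Ring A] (𝒜 : ZMod 2 → AddSubgroup A) [GradedRing 𝒜]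

theorem exists_even_add_odd (a : A) : ∃ e ∈ 𝒜 0, ∃ o ∈ 𝒜 1, a = e + o := by
  induction a using DirectSum.Decomposition.inductionOn 𝒜 with
  | zero => exact ⟨0, zero_mem _, 0, zero_mem _, (add_zero 0).symm⟩
  | @homogeneous i m =>
    have hi : ∀ k : ZMod 2, k = 0 ∨ k = 1 := by decide
    rcases hi i with rfl | rfl
    · exact ⟨m, m.2, 0, zero_mem _, (add_zero _).symm⟩
    · exact ⟨0, zero_mem _, m, m.2, (zero_add _).symm⟩
  | add a b ha hb =>
    obtain ⟨e, he, o, ho, rfl⟩ := ha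
    obtain ⟨e', he', o', ho', rfl⟩ := hb
    exact ⟨e + e', add_mem he he', o + o', add_mem ho ho', add_add_add_comm _ _ _ _⟩

variable [SuperCommutative 𝒜]

theorem even_comm {r : A} (hr : r ∈ 𝒜 0) (a : A) : r * a = a * r := by
  obtain ⟨e, he, o, ho, rfl⟩ := exists_even_add_odd 𝒜 a
  rw [mul_add, add_mul, SuperCommutative.even_mul_comm r hr 0 e he,
    SuperCommutative.even_mul_comm r hr 1 o ho]

/-- The even part `A₀`, a commutative ring. -/
instance evenCommRing : CommRing (𝒜 0) :=
  { SetLike.GradeZero.instRing 𝒜 with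
    mul_comm := fun a b => Subtype.ext (even_comm 𝒜 a.2 (b : A)) }

/-- `A` is an algebra over its even part. -/
instance evenAlgebra : Algebra (𝒜 0) A :=
  RingHom.toAlgebra' (SetLike.GradeZero.subring 𝒜).subtype (fun r a => even_comm 𝒜 r.2 a)

theorem even_smul_def (r : 𝒜 0) (a : A) : r • a = (r : A) * a := rfl

/-- The homogeneous component `𝒜 i` as an `A₀`-submodule of `A`. -/
def component (i : ZMod 2) : Submodule (𝒜 0) A :=
  { 𝒜 i with
    smul_mem' := fun r a ha => by
      have h := SetLike.GradedMul.mul_mem (A := 𝒜) r.2 ha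
      rw [zero_add] at h
      exact h }

/-- The super-ideal `I_A = A A₁`. -/
def oddIdeal : Ideal A := Ideal.span (𝒜 1 : Set A)

instance oddIdeal_isTwoSided : (oddIdeal 𝒜).IsTwoSided where
  mul_mem_of_left {a} b ha := by
    induction ha using Submodule.span_induction with
    | mem x hx =>
      obtain ⟨e, he, o, ho, rfl⟩ := exists_even_add_odd 𝒜 b
      rw [mul_add, ← even_comm 𝒜 he, odd_anticomm 𝒜 hx ho]
      exact add_mem (Ideal.mul_mem_left _ _ (Ideal.subset_span hx))
        (neg_mem (Ideal.mul_mem_left _ _ (Ideal.subset_span hx)))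
    | zero => rw [zero_mul]; exact zero_mem _
    | add x y _ _ hx hy => rw [add_mul]; exact add_mem hx hy
    | smul r x _ hx => rw [smul_eq_mul, mul_assoc]; exact Ideal.mul_mem_left _ _ hx

/-- The ring `A / I_A`. -/
abbrev Body : Type u := A ⧸ oddIdeal 𝒜

/-- Every element of `A / I_A` is represented by an even element. -/
theorem body_exists_even (a : Body 𝒜) :
    ∃ e : 𝒜 0, Ideal.Quotient.mk (oddIdeal 𝒜) (e : A) = a := by
  obtain ⟨a, rfl⟩ := Ideal.Quotient.mk_surjective a
  obtain ⟨e, he, o, ho, rfl⟩ := exists_even_add_odd 𝒜 a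
  refine ⟨⟨e, he⟩, ?_⟩
  have h : Ideal.Quotient.mk (oddIdeal 𝒜) o = 0 :=
    Ideal.Quotient.eq_zero_iff_mem.2 (Ideal.subset_span ho)
  rw [map_add, h, add_zero]

instance bodyCommRing : CommRing (Body 𝒜) :=
  { Ideal.Quotient.ring (oddIdeal 𝒜) with
    mul_comm := fun a b => by
      obtain ⟨e, rfl⟩ := body_exists_even 𝒜 a
      obtain ⟨b, rfl⟩ := Ideal.Quotient.mk_surjective b
      exact congrArg (Ideal.Quotient.mk (oddIdeal 𝒜)) (even_comm 𝒜 e.2 b) }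

end Basic

/-! ## The associated graded ring of a two-sided ideal -/

section AssociatedGraded

variable {R : Type u} [Ring R] (I : Ideal R)

/-- The piece `Iⁿ / Iⁿ⁺¹`. -/
def GrPiece (n : ℕ) : Type u :=
  ↥(I ^ n) ⧸ Submodule.submoduleOf (I ^ (n + 1)) (I ^ n)

instance grPieceAddCommGroup (n : ℕ) : AddCommGroup (GrPiece I n) :=
  Submodule.Quotient.addCommGroup (Submodule.submoduleOf (I ^ (n + 1)) (I ^ n))

instance grPieceModule (n : ℕ) : Module R (GrPiece I n) :=
  Submodule.Quotient.module (Submodule.submoduleOf (I ^ (n + 1)) (I ^ n))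

/-- The class in `Iⁿ / Iⁿ⁺¹` of an element of `Iⁿ`. -/
def grMk (n : ℕ) (x : ↥(I ^ n)) : GrPiece I n := Submodule.Quotient.mk x

theorem grMk_surjective (n : ℕ) : Function.Surjective (grMk I n) :=
  Submodule.Quotient.mk_surjective _

theorem grMk_eq_iff {n : ℕ} {x y : ↥(I ^ n)} :
    grMk I n x = grMk I n y ↔ (x : R) - y ∈ I ^ (n + 1) :=
  (Submodule.Quotient.eq (Submodule.submoduleOf (I ^ (n + 1)) (I ^ n))).trans Iff.rfl

theorem grMk_congr {m n : ℕ} (h : m = n) (x : ↥(I ^ m)) (y : ↥(I ^ n)) (hxy : (x : R) = y) :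
    (GradedMonoid.mk m (grMk I m x) : GradedMonoid (GrPiece I)) =
      GradedMonoid.mk n (grMk I n y) := by
  subst h
  rw [Subtype.ext hxy]

theorem grMk_add {n : ℕ} (x y : ↥(I ^ n)) : grMk I n (x + y) = grMk I n x + grMk I n y := rfl

variable [I.IsTwoSided]

theorem mul_mem_pow_add {m n : ℕ} {x y : R} (hx : x ∈ I ^ m) (hy : y ∈ I ^ n) :
    x * y ∈ I ^ (m + n) := by
  rw [Ideal.IsTwoSided.pow_add]
  exact Ideal.mul_mem_mul hx hy

/-- Multiplication `Iᵐ / Iᵐ⁺¹ × Iⁿ / Iⁿ⁺¹ → Iᵐ⁺ⁿ / Iᵐ⁺ⁿ⁺¹`, induced by that of `R`. -/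
def grMul {m n : ℕ} (a : GrPiece I m) (b : GrPiece I n) : GrPiece I (m + n) :=
  Quotient.liftOn₂' a b
    (fun x y => grMk I (m + n) ⟨(x : R) * y, mul_mem_pow_add I x.2 y.2⟩)
    (fun x y x' y' hx hy => by
      have hx' : (x : R) - x' ∈ I ^ (m + 1) := (grMk_eq_iff I).1 (Quotient.sound' hx)
      have hy' : (y : R) - y' ∈ I ^ (n + 1) := (grMk_eq_iff I).1 (Quotient.sound' hy)
      rw [grMk_eq_iff]
      have h1 := mul_mem_pow_add I hx' y.2
      have h2 := mul_mem_pow_add I x'.2 hy'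
      rw [Nat.add_right_comm] at h1
      rw [← Nat.add_assoc] at h2
      have h3 := add_mem h1 h2
      have h4 : (x : R) * y - x' * y' = (x - x') * y + x' * (y - y') := by noncomm_ring
      exact h4 ▸ h3)

theorem grMul_mk {m n : ℕ} (x : ↥(I ^ m)) (y : ↥(I ^ n)) :
    grMul I (grMk I m x) (grMk I n y) =
      grMk I (m + n) ⟨(x : R) * y, mul_mem_pow_add I x.2 y.2⟩ := rfl

/-- The unit of the associated graded ring, in degree zero. -/
def grOne : GrPiece I 0 := grMk I 0 ⟨1, by rw [Submodule.pow_zero, Ideal.one_eq_top]; trivial⟩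

instance grGMul : GradedMonoid.GMul (GrPiece I) where
  mul a b := grMul I a b

instance grGOne : GradedMonoid.GOne (GrPiece I) where
  one := grOne I

/-- The graded ring structure on the family `Iⁿ / Iⁿ⁺¹`, making `⨁ n, Iⁿ / Iⁿ⁺¹` a ring. -/
instance grGRing : DirectSum.GRing (GrPiece I) where
  mul_zero {i j} a := by
    obtain ⟨x, rfl⟩ := grMk_surjective I i a
    change grMul I (grMk I i x) (grMk I j 0) = grMk I (i + j) 0
    rw [grMul_mk]
    congr 1
    exact Subtype.ext (mul_zero _)
  zero_mul {i j} b := by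
    obtain ⟨y, rfl⟩ := grMk_surjective I j b
    change grMul I (grMk I i 0) (grMk I j y) = grMk I (i + j) 0
    rw [grMul_mk]
    congr 1
    exact Subtype.ext (zero_mul _)
  mul_add {i j} a b c := by
    obtain ⟨x, rfl⟩ := grMk_surjective I i a
    obtain ⟨y, rfl⟩ := grMk_surjective I j b
    obtain ⟨z, rfl⟩ := grMk_surjective I j c
    change grMul I (grMk I i x) (grMk I j (y + z)) =
      grMul I (grMk I i x) (grMk I j y) + grMul I (grMk I i x) (grMk I j z)
    rw [grMul_mk, grMul_mk, grMul_mk, ← grMk_add]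
    congr 1
    exact Subtype.ext (mul_add _ _ _)
  add_mul {i j} a b c := by
    obtain ⟨x, rfl⟩ := grMk_surjective I i a
    obtain ⟨y, rfl⟩ := grMk_surjective I i b
    obtain ⟨z, rfl⟩ := grMk_surjective I j c
    change grMul I (grMk I i (x + y)) (grMk I j z) =
      grMul I (grMk I i x) (grMk I j z) + grMul I (grMk I i y) (grMk I j z)
    rw [grMul_mk, grMul_mk, grMul_mk, ← grMk_add]
    congr 1
    exact Subtype.ext (add_mul _ _ _)
  one_mul := by
    rintro ⟨n, a⟩
    obtain ⟨x, rfl⟩ := grMk_surjective I n a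
    exact grMk_congr I (zero_add n) _ _ (one_mul _)
  mul_one := by
    rintro ⟨n, a⟩
    obtain ⟨x, rfl⟩ := grMk_surjective I n a
    exact grMk_congr I (add_zero n) _ _ (mul_one _)
  mul_assoc := by
    rintro ⟨l, a⟩ ⟨m, b⟩ ⟨n, c⟩
    obtain ⟨x, rfl⟩ := grMk_surjective I l a
    obtain ⟨y, rfl⟩ := grMk_surjective I m b
    obtain ⟨z, rfl⟩ := grMk_surjective I n c
    exact grMk_congr I (add_assoc l m n) _ _ (mul_assoc _ _ _)
  natCast n := n • grOne I
  natCast_zero := zero_smul _ _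
  natCast_succ n := succ_nsmul _ _
  intCast n := n • grOne I
  intCast_ofNat n := natCast_zsmul _ _
  intCast_negSucc_ofNat n := negSucc_zsmul _ _

/-- `Iⁿ / Iⁿ⁺¹` is annihilated by `I`. -/
theorem grPiece_isTorsionBySet (n : ℕ) : Module.IsTorsionBySet R (GrPiece I n) I := by
  rintro a ⟨r, hr⟩
  obtain ⟨x, rfl⟩ := grMk_surjective I n a
  change grMk I n (r • x) = grMk I n 0
  rw [grMk_eq_iff]
  change r * (x : R) - 0 ∈ _
  rw [sub_zero, Ideal.IsTwoSided.pow_succ]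
  exact Ideal.mul_mem_mul hr x.2

end AssociatedGraded

section Lambda

variable {A : Type u} [Ring A] (𝒜 : ZMod 2 → AddSubgroup A) [GradedRing 𝒜] [SuperCommutative 𝒜]

/-- The piece `I_Aⁿ / I_Aⁿ⁺¹` of `gr_{I_A}(A)`. -/
abbrev OddGr (n : ℕ) : Type u := GrPiece (oddIdeal 𝒜) n

/-- `I_Aⁿ / I_Aⁿ⁺¹` is a module over `A / I_A`, the action being induced by that of `A`. -/
noncomputable instance oddGrModule (n : ℕ) : Module (Body 𝒜) (OddGr 𝒜 n) :=
  (grPiece_isTorsionBySet (oddIdeal 𝒜) n).module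

theorem body_smul_mk (n : ℕ) (r : A) (x : ↥(oddIdeal 𝒜 ^ n)) :
    Ideal.Quotient.mk (oddIdeal 𝒜) r • grMk (oddIdeal 𝒜) n x = grMk (oddIdeal 𝒜) n (r • x) := rfl

/-- The structure map of the `A / I_A`-algebra `gr_{I_A}(A) = ⨁ n, I_Aⁿ / I_Aⁿ⁺¹`: it sends the
class of `a` to the class of `a` in degree zero. -/
noncomputable instance oddGrAlgebra : DirectSum.GAlgebra (Body 𝒜) (OddGr 𝒜) where
  toFun := (LinearMap.toSpanSingleton (Body 𝒜) (OddGr 𝒜 0) (grOne (oddIdeal 𝒜))).toAddMonoidHom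
  map_one := one_smul (Body 𝒜) (grOne (oddIdeal 𝒜))
  map_mul r s := by
    obtain ⟨a, rfl⟩ := Ideal.Quotient.mk_surjective r
    obtain ⟨b, rfl⟩ := Ideal.Quotient.mk_surjective s
    refine grMk_congr (oddIdeal 𝒜) (zero_add 0).symm _ _ ?_
    change a * b * 1 = (a * 1) * (b * 1)
    simp only [mul_one]
  commutes := by
    rintro r ⟨n, x⟩
    obtain ⟨e, rfl⟩ := body_exists_even 𝒜 r
    obtain ⟨x, rfl⟩ := grMk_surjective (oddIdeal 𝒜) n x
    refine grMk_congr (oddIdeal 𝒜) ((zero_add n).trans (add_zero n).symm) _ _ ?_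
    change ((e : A) * 1) * (x : A) = x * (e * 1)
    rw [mul_one, even_comm 𝒜 e.2]
  smul_def := by
    rintro r ⟨n, x⟩
    obtain ⟨a, rfl⟩ := Ideal.Quotient.mk_surjective r
    obtain ⟨x, rfl⟩ := grMk_surjective (oddIdeal 𝒜) n x
    refine grMk_congr (oddIdeal 𝒜) (zero_add n).symm _ _ ?_
    change a * (x : A) = (a * 1) * x
    rw [mul_one]

/-- The graded algebra `gr_{I_A}(A) = ⨁ n, I_Aⁿ / I_Aⁿ⁺¹`. -/
abbrev AssocGr : Type u := DirectSum ℕ (OddGr 𝒜)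

noncomputable instance assocGrRing : Ring (AssocGr 𝒜) := inferInstance

noncomputable instance assocGrAlgebra : Algebra (Body 𝒜) (AssocGr 𝒜) := inferInstance

/-- The embedding of `I_A / I_A²` in `gr_{I_A}(A)`. -/
noncomputable def grEmbedding : OddGr 𝒜 1 →ₗ[Body 𝒜] AssocGr 𝒜 :=
  DirectSum.lof (Body 𝒜) ℕ (OddGr 𝒜) 1

theorem exists_odd_add_sq {x : A} (hx : x ∈ oddIdeal 𝒜) :
    ∃ o ∈ 𝒜 1, ∃ t ∈ oddIdeal 𝒜 ^ 2, x = o + t := by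
  induction hx using Submodule.span_induction with
  | mem x hx => exact ⟨x, hx, 0, zero_mem _, (add_zero x).symm⟩
  | zero => exact ⟨0, zero_mem _, 0, zero_mem _, (add_zero 0).symm⟩
  | add x y _ _ hx hy =>
    obtain ⟨o, ho, t, ht, rfl⟩ := hx
    obtain ⟨o', ho', t', ht', rfl⟩ := hy
    exact ⟨o + o', add_mem ho ho', t + t', add_mem ht ht', add_add_add_comm _ _ _ _⟩
  | smul r x _ hx =>
    obtain ⟨o, ho, t, ht, rfl⟩ := hx
    obtain ⟨e, he, p, hp, rfl⟩ := exists_even_add_odd 𝒜 r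
    have h1 : e * o ∈ 𝒜 1 := (component 𝒜 1).smul_mem ⟨e, he⟩ ho
    have h2 : p * o ∈ oddIdeal 𝒜 ^ 2 := by
      rw [Ideal.IsTwoSided.pow_succ, Submodule.pow_one]
      exact Ideal.mul_mem_mul (Ideal.subset_span hp) (Ideal.subset_span ho)
    refine ⟨e * o, h1, p * o + (e + p) * t, add_mem h2 (Ideal.mul_mem_left _ _ ht), ?_⟩
    rw [smul_eq_mul]
    noncomm_ring

/-- The square of an element of `I_A` lies in `I_A³`. -/
theorem sq_mem_cube {x : A} (hx : x ∈ oddIdeal 𝒜) : x * x ∈ oddIdeal 𝒜 ^ 3 := by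
  obtain ⟨o, ho, t, ht, rfl⟩ := exists_odd_add_sq 𝒜 hx
  have hoI : o ∈ oddIdeal 𝒜 ^ 1 := by
    rw [Submodule.pow_one]
    exact Ideal.subset_span ho
  have h1 : o * t ∈ oddIdeal 𝒜 ^ (1 + 2) := mul_mem_pow_add _ hoI ht
  have h2 : t * o ∈ oddIdeal 𝒜 ^ (2 + 1) := mul_mem_pow_add _ ht hoI
  have h3 : t * t ∈ oddIdeal 𝒜 ^ (2 + 1) := by
    refine mul_mem_pow_add _ ht ?_
    have h : o + t - o ∈ oddIdeal 𝒜 := sub_mem hx (Ideal.subset_span ho)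
    rwa [add_sub_cancel_left, ← Submodule.pow_one (oddIdeal 𝒜)] at h
  have h4 : (o + t) * (o + t) = o * t + (t * o + t * t) := by
    rw [mul_add, add_mul, add_mul, SuperCommutative.odd_mul_self (𝒜 := 𝒜) o ho, zero_add]
    abel
  rw [h4]
  exact add_mem h1 (add_mem h2 h3)

theorem grEmbedding_sq (m : OddGr 𝒜 1) : grEmbedding 𝒜 m * grEmbedding 𝒜 m = 0 := by
  obtain ⟨x, rfl⟩ := grMk_surjective (oddIdeal 𝒜) 1 m
  change DirectSum.of (OddGr 𝒜) 1 _ * DirectSum.of (OddGr 𝒜) 1 _ = 0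
  rw [DirectSum.of_mul_of]
  have h : grMul (oddIdeal 𝒜) (grMk (oddIdeal 𝒜) 1 x) (grMk (oddIdeal 𝒜) 1 x) =
      grMk (oddIdeal 𝒜) (1 + 1) 0 := by
    rw [grMul_mk, grMk_eq_iff]
    change (x : A) * x - 0 ∈ _
    rw [sub_zero]
    exact sq_mem_cube 𝒜 ((Submodule.pow_one (oddIdeal 𝒜)).le x.2)
  change DirectSum.of (OddGr 𝒜) (1 + 1) (grMul (oddIdeal 𝒜) _ _) = 0
  rw [h]
  exact map_zero (DirectSum.of (OddGr 𝒜) (1 + 1))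

/-- The algebra map `λ_A : ⋀ (I_A / I_A²) → gr_{I_A}(A)` over `A / I_A`, induced by the
embedding of `I_A / I_A²` in `gr_{I_A}(A)`. -/
noncomputable def lam : ExteriorAlgebra (Body 𝒜) (OddGr 𝒜 1) →ₐ[Body 𝒜] AssocGr 𝒜 :=
  ExteriorAlgebra.lift (Body 𝒜) ⟨grEmbedding 𝒜, grEmbedding_sq 𝒜⟩

end Lambda

/-! ## Noetherian super-rings and localization -/

/-- A super-ring is Noetherian if its super-ideals (that is, its homogeneous ideals) satisfy the
ascending chain condition. -/
def IsNoetherianSuperRing {A : Type u} [Ring A] (𝒜 : ZMod 2 → AddSubgroup A) [GradedRing 𝒜] :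
    Prop :=
  WellFoundedGT (HomogeneousIdeal 𝒜)

section Localization

variable {A : Type u} [Ring A] (𝒜 : ZMod 2 → AddSubgroup A) [GradedRing 𝒜] [SuperCommutative 𝒜]

/-- The ideal `𝔭₀ = 𝔭 ∩ A₀` of `A₀`, for a super-ideal `𝔭`. -/
def evenPart (𝔭 : HomogeneousIdeal 𝒜) : Ideal (𝒜 0) :=
  𝔭.toIdeal.comap (algebraMap (𝒜 0) A)

/-- The multiplicative set `A₀ ∖ 𝔭₀` of a prime super-ideal. A super-ideal `𝔭` is prime if
`A / 𝔭` is a domain, which is the meaning of `𝔭.toIdeal.IsPrime`. -/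
def evenCompl (𝔭 : HomogeneousIdeal 𝒜) [h : 𝔭.toIdeal.IsPrime] : Submonoid (𝒜 0) where
  carrier := {s | s ∉ evenPart 𝒜 𝔭}
  one_mem' := fun h1 => h.ne_top ((Ideal.eq_top_iff_one _).2 h1)
  mul_mem' := fun ha hb hab => (h.mem_or_mem hab).elim ha hb

variable (S : Submonoid (𝒜 0))

/-- The grading of `S⁻¹ A`, for a multiplicative set `S` of even elements: the component of
degree `i` consists of the fractions `a / s` with `a` of degree `i`. -/
def locGrading (i : ZMod 2) : AddSubgroup (LocalizedModule S A) where
  carrier := {x | ∃ a ∈ 𝒜 i, ∃ s : S, x = LocalizedModule.mk a s}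
  zero_mem' := ⟨0, zero_mem _, 1, (LocalizedModule.zero_mk 1).symm⟩
  add_mem' := by
    rintro _ _ ⟨a, ha, s, rfl⟩ ⟨b, hb, t, rfl⟩
    exact ⟨t • a + s • b, add_mem ((component 𝒜 i).smul_mem (t : 𝒜 0) ha)
      ((component 𝒜 i).smul_mem (s : 𝒜 0) hb), s * t, LocalizedModule.mk_add_mk⟩
  neg_mem' := by
    rintro _ ⟨a, ha, s, rfl⟩
    exact ⟨-a, neg_mem ha, s, LocalizedModule.mk_neg.symm⟩

instance locGradedMonoid : SetLike.GradedMonoid (locGrading 𝒜 S) where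
  one_mem := ⟨1, SetLike.GradedOne.one_mem, 1, OreLocalization.one_def⟩
  mul_mem := by
    rintro i j _ _ ⟨a, ha, s, rfl⟩ ⟨b, hb, t, rfl⟩
    exact ⟨a * b, SetLike.GradedMul.mul_mem ha hb, s * t, LocalizedModule.mk_mul_mk⟩

/-- The projection of `A` to its component of degree `i`, as an `A₀`-linear map. -/
def evenProj (i : ZMod 2) : A →ₗ[𝒜 0] A where
  toFun a := DirectSum.decompose 𝒜 a i
  map_add' a b := by simp
  map_smul' r a := by
    rw [even_smul_def, RingHom.id_apply, even_smul_def]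
    exact DirectSum.coe_decompose_mul_of_left_mem_zero 𝒜 r.2

/-- The projection of `S⁻¹ A` to its component of degree `i`. -/
noncomputable def locProj (i : ZMod 2) : LocalizedModule S A →+ locGrading 𝒜 S i :=
  (LocalizedModule.map S (evenProj 𝒜 i)).toAddMonoidHom.codRestrict (locGrading 𝒜 S i) (by
    intro x
    induction x with
    | _ a s => exact ⟨_, SetLike.coe_mem (DirectSum.decompose 𝒜 a i), s, LocalizedModule.map_mk _ _ _ _⟩)

theorem locProj_mk (i : ZMod 2) (a : A) (s : S) :
    (locProj 𝒜 S i (LocalizedModule.mk a s) : LocalizedModule S A) =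
      LocalizedModule.mk (DirectSum.decompose 𝒜 a i : A) s :=
  LocalizedModule.map_mk _ _ _ _

/-- The decomposition of an element of `S⁻¹ A` into its homogeneous components. -/
noncomputable def locDecompose : LocalizedModule S A →+ DirectSum (ZMod 2) (fun i => locGrading 𝒜 S i) :=
  ∑ i : ZMod 2, (DirectSum.of (fun i => locGrading 𝒜 S i) i).comp (locProj 𝒜 S i)

theorem mk_sum {ι : Type} (t : Finset ι) (f : ι → A) (s : S) :
    (LocalizedModule.mk (∑ i ∈ t, f i) s : LocalizedModule S A) =
      ∑ i ∈ t, LocalizedModule.mk (f i) s := by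
  classical
  induction t using Finset.induction_on with
  | empty => simp
  | insert i t hi ih =>
    rw [Finset.sum_insert hi, Finset.sum_insert hi, ← ih, LocalizedModule.mk_add_mk, ← smul_add,
      LocalizedModule.mk_cancel_common_left]

theorem sum_decompose (a : A) : ∑ i : ZMod 2, (DirectSum.decompose 𝒜 a i : A) = a := by
  induction a using DirectSum.Decomposition.inductionOn 𝒜 with
  | zero => simp
  | @homogeneous i m =>
    rw [Finset.sum_eq_single i]
    · exact DirectSum.decompose_of_mem_same 𝒜 m.2
    · exact fun j _ hj => DirectSum.decompose_of_mem_ne 𝒜 m.2 hj.symm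
    · exact fun h => absurd (Finset.mem_univ i) h
  | add a b ha hb =>
    rw [DirectSum.decompose_add]
    simp only [DirectSum.add_apply, AddSubgroup.coe_add, Finset.sum_add_distrib, ha, hb]

theorem locDecompose_left_inv :
    (DirectSum.coeAddMonoidHom (locGrading 𝒜 S)).comp (locDecompose 𝒜 S) = .id _ := by
  ext x
  induction x with
  | _ a s =>
    simp only [locDecompose, AddMonoidHom.comp_apply, AddMonoidHom.finsetSum_apply, map_sum,
      DirectSum.coeAddMonoidHom_of, locProj_mk, AddMonoidHom.id_apply]
    rw [← mk_sum, sum_decompose]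

theorem locDecompose_right_inv :
    (locDecompose 𝒜 S).comp (DirectSum.coeAddMonoidHom (locGrading 𝒜 S)) = .id _ := by
  refine DirectSum.addHom_ext' fun j => AddMonoidHom.ext fun x => ?_
  obtain ⟨_, a, ha, s, rfl⟩ := x
  simp only [locDecompose, AddMonoidHom.comp_apply, AddMonoidHom.finsetSum_apply,
    DirectSum.coeAddMonoidHom_of, AddMonoidHom.id_apply]
  rw [Finset.sum_eq_single j]
  · congr 1
    refine Subtype.ext ?_
    rw [locProj_mk, DirectSum.decompose_of_mem_same 𝒜 ha]
  · intro i _ hij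
    have h : locProj 𝒜 S i (LocalizedModule.mk a s) = 0 := by
      refine Subtype.ext ?_
      rw [locProj_mk, DirectSum.decompose_of_mem_ne 𝒜 ha hij.symm, LocalizedModule.zero_mk]
      rfl
    rw [h, map_zero]
  · intro h
    exact absurd (Finset.mem_univ j) h

noncomputable instance locGradedRing : GradedRing (locGrading 𝒜 S) where
  toDecomposition := DirectSum.Decomposition.ofAddHom _ (locDecompose 𝒜 S)
    (locDecompose_left_inv 𝒜 S) (locDecompose_right_inv 𝒜 S)

instance locSuperCommutative : SuperCommutative (locGrading 𝒜 S) where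
  even_mul_comm := by
    rintro _ ⟨a, ha, s, rfl⟩ i _ ⟨b, hb, t, rfl⟩
    rw [LocalizedModule.mk_mul_mk, LocalizedModule.mk_mul_mk, even_comm 𝒜 ha, mul_comm s t]
  odd_mul_self := by
    rintro _ ⟨a, ha, s, rfl⟩
    rw [LocalizedModule.mk_mul_mk, SuperCommutative.odd_mul_self (𝒜 := 𝒜) a ha,
      LocalizedModule.zero_mk]

end Localization

/-! ## Krull super-dimension and regularity -/

section Regular

variable {R : Type u} [Ring R] (𝓡 : ZMod 2 → AddSubgroup R) [GradedRing 𝓡] [SuperCommutative 𝓡]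

/-- The ideal `Ann_{R₀}(z)`. -/
def evenAnn (z : R) : Ideal (𝓡 0) where
  carrier := {r | (r : R) * z = 0}
  zero_mem' := zero_mul z
  add_mem' {a b} ha hb := by
    change ((a : R) + b) * z = 0
    rw [add_mul, show (a : R) * z = 0 from ha, show (b : R) * z = 0 from hb, add_zero]
  smul_mem' c a ha := by
    change ((c : R) * a) * z = 0
    rw [mul_assoc, show (a : R) * z = 0 from ha, mul_zero]

/-- Odd elements `y₁, …, yₛ` form a system of odd parameters if
`Kdim (R₀) = Kdim (R₀ / Ann_{R₀}(y₁ ⋯ yₛ))`. -/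
def IsOddParameterSystem {s : ℕ} (y : Fin s → R) : Prop :=
  (∀ i, y i ∈ 𝓡 1) ∧
    ringKrullDim (𝓡 0) = ringKrullDim (𝓡 0 ⧸ evenAnn 𝓡 (List.ofFn y).prod)

/-- The even Krull dimension of `R`. -/
noncomputable def evenKrullDim : WithBot ℕ∞ := ringKrullDim (𝓡 0)

/-- The odd Krull dimension of `R`: the largest length of a system of odd parameters. -/
noncomputable def oddKrullDim : ℕ∞ :=
  ⨆ (s : ℕ) (_ : ∃ y : Fin s → R, IsOddParameterSystem 𝓡 y), (s : ℕ∞)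

variable (𝔪 : HomogeneousIdeal 𝓡)

/-- The residue ring `R₀ / 𝔪₀`; for a maximal super-ideal `𝔪` this is the field `R / 𝔪`. -/
abbrev Residue : Type u := 𝓡 0 ⧸ evenPart 𝓡 𝔪

/-- The component `𝔪ᵢ = 𝔪 ∩ Rᵢ`, as an `R₀`-module. -/
def idealComponent (i : ZMod 2) : Submodule (𝓡 0) R :=
  𝔪.toIdeal.restrictScalars (𝓡 0) ⊓ component 𝓡 i

/-- The component of degree `i` of `𝔪 / 𝔪²`. -/
def Cotangent (i : ZMod 2) : Type u :=
  ↥(idealComponent 𝓡 𝔪 i) ⧸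
    Submodule.submoduleOf ((𝔪.toIdeal ^ 2).restrictScalars (𝓡 0)) (idealComponent 𝓡 𝔪 i)

instance cotangentAddCommGroup (i : ZMod 2) : AddCommGroup (Cotangent 𝓡 𝔪 i) :=
  Submodule.Quotient.addCommGroup
    (Submodule.submoduleOf ((𝔪.toIdeal ^ 2).restrictScalars (𝓡 0)) (idealComponent 𝓡 𝔪 i))

instance cotangentEvenModule (i : ZMod 2) : Module (𝓡 0) (Cotangent 𝓡 𝔪 i) :=
  Submodule.Quotient.module
    (Submodule.submoduleOf ((𝔪.toIdeal ^ 2).restrictScalars (𝓡 0)) (idealComponent 𝓡 𝔪 i))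

theorem cotangent_isTorsionBySet (i : ZMod 2) :
    Module.IsTorsionBySet (𝓡 0) (Cotangent 𝓡 𝔪 i) (evenPart 𝓡 𝔪) := by
  rintro a ⟨r, hr⟩
  obtain ⟨x, rfl⟩ := Submodule.Quotient.mk_surjective _ a
  refine (Submodule.Quotient.mk_eq_zero _ (x := r • x)).2 ?_
  change (r : R) * (x : R) ∈ 𝔪.toIdeal ^ 2
  have h := Ideal.mul_mem_mul (I := 𝔪.toIdeal) (J := 𝔪.toIdeal) hr x.2.1
  rw [Submodule.pow_succ, Submodule.pow_one]
  exact h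

/-- `(𝔪 / 𝔪²)ᵢ` is a module over the residue ring. -/
instance cotangentModule (i : ZMod 2) : Module (Residue 𝓡 𝔪) (Cotangent 𝓡 𝔪 i) :=
  (cotangent_isTorsionBySet 𝓡 𝔪 i).module

/-- The dimension of the super-vector space `𝔪 / 𝔪²` in degree `i`. -/
noncomputable def cotangentDim (i : ZMod 2) : ℕ∞ :=
  Cardinal.toENat (Module.rank (Residue 𝓡 𝔪) (Cotangent 𝓡 𝔪 i))

/-- `R` is local with maximal super-ideal `𝔪`: it is the unique super-ideal such that `R / 𝔪` is
a field, which is the meaning of `𝔪.toIdeal.IsMaximal`. -/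
def IsLocalWith : Prop :=
  ∀ 𝔫 : HomogeneousIdeal 𝓡, 𝔫.toIdeal.IsMaximal ↔ 𝔫 = 𝔪

/-- A local super-ring `R` is regular if `Ksdim R = sdim (𝔪 / 𝔪²)`, where `𝔪` is its maximal
super-ideal. -/
def IsRegularLocal : Prop :=
  ∃ 𝔪 : HomogeneousIdeal 𝓡, IsLocalWith 𝓡 𝔪 ∧
    evenKrullDim 𝓡 = (cotangentDim 𝓡 𝔪 0 : WithBot ℕ∞) ∧ oddKrullDim 𝓡 = cotangentDim 𝓡 𝔪 1

/-- A super-ring is regular if its localizations at all prime super-ideals are regular local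
super-rings. -/
def IsRegular : Prop :=
  ∀ (𝔭 : HomogeneousIdeal 𝓡) [𝔭.toIdeal.IsPrime],
    IsRegularLocal (locGrading 𝓡 (evenCompl 𝓡 𝔭))

end Regular

end SuperRing

/-!
The even part `A₀` maps onto the body `Ā` with nilpotent kernel, so the primes of `A`, the primes
of `Ā` and the localizations at them correspond to each other.

Suppose that `A` is local. Its two cotangent dimensions are the embedding dimension of `Ā` and the
minimal number of generators of `A₁`. If `Ā` is regular, then it is a domain, so killing a
non-nilpotent element of `A₀` lowers the dimension; hence `y₁, …, yₛ` are odd parameters exactly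
when `Ann(y₁ ⋯ yₛ)` lies in the kernel of `A₀ → Ā`. Thus `A` is regular if and only if `Ā` is
regular and `A₁` has generators `z₁, …, zₛ` with `Ann(z₁ ⋯ zₛ)` in that kernel.

Multiplying a relation `∑ c_J z_J` by the product of the `zᵢ` with `i ∉ J` leaves `± c_J z₁ ⋯ zₛ`.
So the condition on the `zᵢ` says that the monomials `z_J` are linearly independent in the
associated graded ring, that is, that `I / I²` is free on the classes of the `zᵢ` and `lam`, which
is always surjective, is injective. Both properties are local on `Ā`.
-/

section RegularLocalRing

open IsLocalRing

theorem exists_span_insert_range_eq_top {K V : Type*} [Field K] [AddCommGroup V] [Module K V]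
    [FiniteDimensional K V] {n : ℕ} (hn : Module.finrank K V = n + 1) {v : V} (hv : v ≠ 0) :
    ∃ w : Fin n → V, Submodule.span K (insert v (Set.range w)) = ⊤ := by
  obtain ⟨W, hW⟩ := Submodule.exists_isCompl (Submodule.span K {v})
  have hdim : Module.finrank K W = n := by
    have h := Submodule.finrank_add_eq_of_isCompl hW
    rw [finrank_span_singleton hv, hn] at h
    omega
  let b := Module.finBasisOfFinrankEq K W hdim
  refine ⟨fun i => b i, ?_⟩
  have hb : Submodule.span K (Set.range fun i => (b i : V)) = W := by
    rw [show (fun i => (b i : V)) = W.subtype ∘ b from rfl, Set.range_comp, Submodule.span_image,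
      b.span_eq, Submodule.map_top, Submodule.range_subtype]
  rw [Submodule.span_insert, hb, hW.sup_eq_top]

theorem exists_maximalIdeal_eq_span_insert_range {R : Type*} [CommRing R] [IsLocalRing R]
    [IsNoetherianRing R] {n : ℕ} (hn : (maximalIdeal R).spanFinrank = n + 1) {x : R}
    (hx : x ∈ maximalIdeal R) (hx2 : x ∉ maximalIdeal R ^ 2) :
    ∃ y : Fin n → R, maximalIdeal R = Ideal.span (insert x (Set.range y)) := by
  rw [spanFinrank_maximalIdeal_eq_finrank_cotangentSpace] at hn
  have hx0 : (maximalIdeal R).toCotangent ⟨x, hx⟩ ≠ 0 := fun h =>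
    hx2 ((Ideal.toCotangent_eq_zero _ _).1 h)
  obtain ⟨w, hw⟩ := exists_span_insert_range_eq_top (K := ResidueField R) hn hx0
  obtain ⟨y, rfl⟩ := (maximalIdeal R).toCotangent_surjective.comp_left w
  rw [Set.range_comp, ← Set.image_insert_eq, CotangentSpace.span_image_eq_top_iff] at hw
  refine ⟨fun i => y i, ?_⟩
  have h := congrArg (Submodule.map (maximalIdeal R).subtype) hw
  rw [Submodule.map_top, Submodule.range_subtype, Submodule.map_span, Set.image_insert_eq,
    ← Set.range_comp] at h
  exact h.symm

theorem spanFinrank_maximalIdeal_quotient_span_singleton_lt {R : Type*} [CommRing R]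
    [IsLocalRing R] [IsNoetherianRing R] {x : R} [IsLocalRing (R ⧸ Ideal.span {x})]
    (hx : x ∈ maximalIdeal R) (hx2 : x ∉ maximalIdeal R ^ 2) :
    (maximalIdeal (R ⧸ Ideal.span {x})).spanFinrank < (maximalIdeal R).spanFinrank := by
  have hm : maximalIdeal R ≠ ⊥ := fun h => hx2 (by rw [h, Ideal.mem_bot] at hx; simp [hx])
  obtain ⟨n, hn⟩ : ∃ n, (maximalIdeal R).spanFinrank = n + 1 :=
    Nat.exists_eq_succ_of_ne_zero
      (mt (Submodule.spanFinrank_eq_zero_iff_eq_bot (maximalIdeal R).fg_of_isNoetherianRing).1 hm)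
  obtain ⟨y, hy⟩ := exists_maximalIdeal_eq_span_insert_range hn hx hx2
  have : IsLocalHom (Ideal.Quotient.mk (Ideal.span {x})) :=
    .of_surjective _ Ideal.Quotient.mk_surjective
  have hmax : maximalIdeal (R ⧸ Ideal.span {x}) =
      Ideal.span (Set.range (Ideal.Quotient.mk (Ideal.span {x}) ∘ y)) := by
    rw [← map_maximalIdeal_of_surjective _ Ideal.Quotient.mk_surjective, hy, Ideal.map_span,
      Set.image_insert_eq, Ideal.Quotient.mk_singleton_self, ← Set.range_comp]
    exact Submodule.span_insert_zero
  rw [hn, Nat.lt_succ_iff, hmax]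
  refine (Submodule.spanFinrank_span_le_ncard_of_finite (Set.finite_range _)).trans ?_
  rw [← Set.image_univ]
  exact (Set.ncard_image_le Set.finite_univ).trans (by simp)

theorem isRegularLocalRing_quotient_span_singleton {R : Type*} [CommRing R]
    [IsRegularLocalRing R] {x : R} (hx : x ∈ maximalIdeal R) (hx2 : x ∉ maximalIdeal R ^ 2) :
    IsRegularLocalRing (R ⧸ Ideal.span {x}) := by
  have : Nontrivial (R ⧸ Ideal.span {x}) :=
    Ideal.Quotient.nontrivial_iff.2 (by rwa [Ne, Ideal.span_singleton_eq_top])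
  have : IsLocalRing (R ⧸ Ideal.span {x}) :=
    IsLocalRing.of_surjective' _ Ideal.Quotient.mk_surjective
  have hspan := spanFinrank_maximalIdeal_quotient_span_singleton_lt hx hx2
  refine .of_spanFinrank_maximalIdeal_le _ (ENat.WithBot.add_le_add_one_right_iff.1 ?_)
  calc (((maximalIdeal (R ⧸ Ideal.span {x})).spanFinrank : WithBot ℕ∞) + 1)
      ≤ (maximalIdeal R).spanFinrank := by exact_mod_cast hspan
    _ = ringKrullDim R := IsRegularLocalRing.spanFinrank_maximalIdeal
    _ = (maximalIdeal R).height := maximalIdeal_height_eq_ringKrullDim.symm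
    _ ≤ ringKrullDim (R ⧸ Ideal.span {x}) + 1 := Ideal.height_le_ringKrullDim_quotient_add_one hx

theorem exists_mem_maximalIdeal_notMem_sq_notMem_minimalPrimes {R : Type*} [CommRing R]
    [IsLocalRing R] [IsNoetherianRing R] (hdim : ringKrullDim R ≠ 0) :
    ∃ x ∈ maximalIdeal R, x ∉ maximalIdeal R ^ 2 ∧ ∀ q ∈ minimalPrimes R, x ∉ q := by
  have hfin := minimalPrimes.finite_of_isNoetherianRing R
  have hmin : maximalIdeal R ∉ minimalPrimes R := fun h => hdim <| by
    rw [← maximalIdeal_height_eq_ringKrullDim, Ideal.height_eq_zero_iff.2 h]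
    rfl
  have hsq : ¬ maximalIdeal R ≤ maximalIdeal R ^ 2 := fun h => by
    have hbot : maximalIdeal R = ⊥ :=
      Submodule.eq_bot_of_le_smul_of_le_jacobson_bot (maximalIdeal R) _
        (maximalIdeal R).fg_of_isNoetherianRing (by rwa [smul_eq_mul, ← pow_two])
        (maximalIdeal_le_jacobson _)
    exact hdim (ringKrullDim_eq_zero_of_isField (isField_iff_maximalIdeal_eq.2 hbot))
  by_contra! hcon
  have hcover : (maximalIdeal R : Set R) ⊆
      ⋃ I ∈ ((insert (maximalIdeal R ^ 2) hfin.toFinset : Finset (Ideal R)) : Set (Ideal R)),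
        ((id I : Ideal R) : Set R) := by
    intro x hx
    by_cases hx2 : x ∈ maximalIdeal R ^ 2
    · exact Set.mem_biUnion (by simp) hx2
    · obtain ⟨q, hq, hxq⟩ := hcon x hx hx2
      exact Set.mem_biUnion (by simp [hq]) hxq
  rw [Ideal.subset_union_prime (maximalIdeal R ^ 2) (maximalIdeal R ^ 2)] at hcover
  · obtain ⟨q, hq, hle⟩ := hcover
    rcases Finset.mem_insert.1 hq with rfl | hq
    · exact hsq hle
    · have hq := hfin.mem_toFinset.1 hq
      exact hmin (le_antisymm hle (le_maximalIdeal hq.1.1.ne_top) ▸ hq)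
  · intro q hq hq2 _
    exact (hfin.mem_toFinset.1 ((Finset.mem_insert.1 hq).resolve_left hq2)).1.1

theorem isDomain_of_isPrime_span_singleton {R : Type*} [CommRing R] [IsLocalRing R]
    [IsNoetherianRing R] {x : R} (hx : x ∈ maximalIdeal R) (hprime : (Ideal.span {x}).IsPrime)
    (hmin : ∀ q ∈ minimalPrimes R, x ∉ q) : IsDomain R := by
  obtain ⟨q, hq, hqx⟩ := Ideal.exists_minimalPrimes_le (bot_le (a := Ideal.span {x}))
  have hqp : q.IsPrime := hq.1.1
  have hle : q ≤ maximalIdeal R • q := fun z hz => by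
    obtain ⟨c, rfl⟩ := Ideal.mem_span_singleton'.1 (hqx hz)
    rw [mul_comm]
    exact Ideal.mul_mem_mul hx ((hqp.mem_or_mem hz).resolve_right (hmin q hq))
  have hq0 : q = ⊥ := Submodule.eq_bot_of_le_smul_of_le_jacobson_bot (maximalIdeal R) _
    q.fg_of_isNoetherianRing hle (maximalIdeal_le_jacobson _)
  rw [hq0] at hqp
  exact IsDomain.of_bot_isPrime R

theorem isDomain_of_isRegularLocalRing (R : Type*) [CommRing R] [IsRegularLocalRing R] :
    IsDomain R := by
  induction hn : (maximalIdeal R).spanFinrank using Nat.strong_induction_on generalizing R with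
  | _ n ih =>
    subst hn
    by_cases hdim : ringKrullDim R = 0
    · rw [← IsRegularLocalRing.spanFinrank_maximalIdeal, Nat.cast_eq_zero,
        Submodule.spanFinrank_eq_zero_iff_eq_bot (maximalIdeal R).fg_of_isNoetherianRing] at hdim
      exact (isField_iff_maximalIdeal_eq.2 hdim).isDomain
    · obtain ⟨x, hx, hx2, hmin⟩ := exists_mem_maximalIdeal_notMem_sq_notMem_minimalPrimes hdim
      have := isRegularLocalRing_quotient_span_singleton hx hx2
      have hdom := ih _ (spanFinrank_maximalIdeal_quotient_span_singleton_lt hx hx2) _ rfl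
      exact isDomain_of_isPrime_span_singleton hx ((Ideal.Quotient.isDomain_iff_prime _).1 hdom)
        hmin

end RegularLocalRing

theorem ringKrullDim_quotient_eq_of_le_nilradical_sup {R : Type*} [CommRing R] {I J : Ideal R}
    (hIJ : I ≤ J) (h : J ≤ I ⊔ nilradical R) : ringKrullDim (R ⧸ I) = ringKrullDim (R ⧸ J) := by
  rw [ringKrullDim_quotient, ringKrullDim_quotient]
  suffices PrimeSpectrum.zeroLocus (I : Set R) = PrimeSpectrum.zeroLocus (J : Set R) by rw [this]
  refine le_antisymm (fun p hp => ?_) (PrimeSpectrum.zeroLocus_anti_mono_ideal hIJ)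
  exact h.trans (sup_le hp (nilradical_le_prime p.asIdeal))

theorem ringKrullDim_quotient_eq_of_le_nilradical {R : Type*} [CommRing R] {I : Ideal R}
    (h : I ≤ nilradical R) : ringKrullDim (R ⧸ I) = ringKrullDim R :=
  (ringKrullDim_quotient_eq_of_le_nilradical_sup bot_le (h.trans le_sup_right)).symm.trans
    (ringKrullDim_eq_of_ringEquiv (RingEquiv.quotientBot R))

theorem ringKrullDim_quotient_eq_iff_le_nilradical {R : Type*} [CommRing R]
    [FiniteRingKrullDim R] (hR : (nilradical R).IsPrime) {I : Ideal R} :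
    ringKrullDim (R ⧸ I) = ringKrullDim R ↔ I ≤ nilradical R := by
  refine ⟨fun h c hc => ?_, ringKrullDim_quotient_eq_of_le_nilradical⟩
  by_contra hcn
  have hsucc := ringKrullDim_succ_le_of_surjective
    (Ideal.Quotient.factor (le_sup_right : nilradical R ≤ I ⊔ nilradical R))
    (Ideal.Quotient.factor_surjective _) (r := Ideal.Quotient.mk _ c)
    (mem_nonZeroDivisors_of_ne_zero (by rwa [Ne, Ideal.Quotient.eq_zero_iff_mem]))
    (by rw [Ideal.Quotient.factor_mk, Ideal.Quotient.eq_zero_iff_mem]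
        exact Ideal.mem_sup_left hc)
  rw [← ringKrullDim_quotient_eq_of_le_nilradical_sup le_sup_left le_rfl, h,
    ringKrullDim_quotient_eq_of_le_nilradical le_rfl] at hsucc
  obtain ⟨d, hd⟩ := WithBot.ne_bot_iff_exists.1 (ringKrullDim_ne_bot (R := R))
  have hd_top : d ≠ ⊤ := fun h => ringKrullDim_ne_top (R := R) (hd ▸ h ▸ rfl)
  rw [← hd] at hsucc
  exact ((ENat.add_one_le_iff hd_top).1 (WithBot.coe_le_coe.1 hsucc)).false

theorem pow_smul_le_sup_pow_smul {R M : Type*} [CommRing R] [AddCommGroup M] [Module R M]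
    {I q : Ideal R} {N C : Submodule R M} (h : I • C ≤ N ⊔ q • C) (k : ℕ) :
    I ^ k • C ≤ N ⊔ q ^ k • C := by
  induction k with
  | zero => simp
  | succ k ih =>
    calc I ^ (k + 1) • C = I • I ^ k • C := by rw [pow_succ', Submodule.mul_smul]
      _ ≤ I • (N ⊔ q ^ k • C) := by gcongr
      _ = I • N ⊔ q ^ k • I • C := by
        rw [Submodule.smul_sup, ← Submodule.mul_smul, mul_comm, Submodule.mul_smul]
      _ ≤ I • N ⊔ q ^ k • (N ⊔ q • C) := by gcongr
      _ = I • N ⊔ (q ^ k • N ⊔ q ^ (k + 1) • C) := by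
        rw [Submodule.smul_sup, pow_succ, Submodule.mul_smul]
      _ ≤ N ⊔ q ^ (k + 1) • C :=
        sup_le (Submodule.smul_le_right.trans le_sup_left)
          (sup_le_sup_right Submodule.smul_le_right _)

theorem exists_fin_spanFinrank_span_range_eq_top (R M : Type*) [Semiring R] [AddCommMonoid M]
    [Module R M] [Module.Finite R M] : ∃ a : Fin (⊤ : Submodule R M).spanFinrank → M,
      Submodule.span R (Set.range a) = ⊤ := by
  obtain ⟨t, ht, hspan⟩ := Submodule.FG.exists_span_finset_card_eq_spanFinrank
    (Module.Finite.fg_top (R := R) (M := M))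
  refine ⟨fun i => (t.equivFinOfCardEq ht).symm i, ?_⟩
  conv_rhs => rw [← hspan]
  rw [Set.range_comp' Subtype.val, Equiv.range_eq_univ, Set.image_univ, Subtype.range_coe]

theorem spanFinrank_top_le_of_span_range_eq_top {R M : Type*} [Semiring R] [AddCommMonoid M]
    [Module R M] {s : ℕ} {a : Fin s → M} (ha : Submodule.span R (Set.range a) = ⊤) :
    (⊤ : Submodule R M).spanFinrank ≤ s := by
  rw [← ha, ← Set.image_univ]
  exact (Submodule.spanFinrank_span_le_ncard_of_finite (Set.toFinite _)).trans
    ((Set.ncard_image_le Set.finite_univ).trans (by simp))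

section AlternatingMap

variable {R M N : Type*} [CommRing R] [AddCommGroup M] [Module R M] [AddCommGroup N] [Module R N]
  {n : ℕ} (f : M [⋀^Fin n]→ₗ[R] N)

theorem alternatingMap_mem_span_orderEmbedding {ι : Type*} [LinearOrder ι] {a : ι → M}
    {v : Fin n → M} (hv : ∀ i, v i ∈ Submodule.span R (Set.range a)) :
    f v ∈ Submodule.span R (Set.range fun e : Fin n ↪o ι => f (a ∘ e)) := by
  let F := exteriorPower.alternatingMapLinearEquiv f
  have hwedge : exteriorPower.ιMulti R n v ∈
      Submodule.span R (Set.range (exteriorPower.ιMulti_family R n a)) := by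
    rw [← exteriorPower.ιMulti_family_span]
    exact ⟨exteriorPower.ιMulti R n fun i => ⟨v i, hv i⟩, exteriorPower.map_apply_ιMulti _ _⟩
  have h := Submodule.mem_map_of_mem (f := F) hwedge
  rw [Submodule.map_span, ← Set.range_comp,
    exteriorPower.alternatingMapLinearEquiv_apply_ιMulti] at h
  refine Submodule.span_mono ?_ h
  rintro _ ⟨J, rfl⟩
  exact ⟨Set.powersetCard.ofFinEmbEquiv.symm J,
    (exteriorPower.alternatingMapLinearEquiv_apply_ιMulti f _).symm⟩

theorem alternatingMap_eq_zero_of_mem_span {s : ℕ} (hsn : s < n) {a : Fin s → M} {v : Fin n → M}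
    (hv : ∀ i, v i ∈ Submodule.span R (Set.range a)) : f v = 0 := by
  have : IsEmpty (Fin n ↪o Fin s) :=
    ⟨fun e => hsn.not_ge (by simpa using Fintype.card_le_of_embedding e.toEmbedding)⟩
  simpa [Set.range_eq_empty] using alternatingMap_mem_span_orderEmbedding f hv

theorem alternatingMap_mem_span_singleton {a v : Fin n → M}
    (hv : ∀ i, v i ∈ Submodule.span R (Set.range a)) : f v ∈ Submodule.span R {f a} := by
  refine Submodule.span_mono ?_ (alternatingMap_mem_span_orderEmbedding f hv)
  rintro _ ⟨e, rfl⟩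
  have he : RelIso.ofSurjective e (Finite.surjective_of_injective e.injective) = OrderIso.refl _ :=
    Subsingleton.elim _ _
  have hae : a ∘ e = a := funext fun i => congrArg a (DFunLike.congr_fun he i)
  simp only [hae, Set.mem_singleton_iff]

theorem pow_smul_mem_span_ιMulti_orderEmbedding {ι : Type*} [LinearOrder ι] {a : ι → M} {t : R}
    (ht : ∀ x : M, t • x ∈ Submodule.span R (Set.range a)) (y : ⋀[R]^n M) :
    t ^ n • y ∈ Submodule.span R
      (Set.range fun e : Fin n ↪o ι => exteriorPower.ιMulti R n (a ∘ e)) := by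
  have hy : y ∈ Submodule.span R (Set.range (exteriorPower.ιMulti R n)) :=
    exteriorPower.ιMulti_span R n M ▸ Submodule.mem_top
  induction hy using Submodule.span_induction with
  | mem y hy =>
    obtain ⟨v, rfl⟩ := hy
    have h := alternatingMap_mem_span_orderEmbedding (exteriorPower.ιMulti R n)
      (v := fun i => t • v i) fun i => ht (v i)
    have hsmul := (exteriorPower.ιMulti R n).toMultilinearMap.map_smul_univ (fun _ => t) v
    rw [Finset.prod_const, Finset.card_univ, Fintype.card_fin] at hsmul
    exact hsmul ▸ h
  | zero => rw [smul_zero]; exact zero_mem _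
  | add x y _ _ hx hy => rw [smul_add]; exact add_mem hx hy
  | smul r x _ hx => rw [smul_comm]; exact Submodule.smul_mem _ r hx

end AlternatingMap

section Append

variable {k l : ℕ}

theorem exists_append_bijective (J : Fin k ↪o Fin (k + l)) :
    ∃ J' : Fin l → Fin (k + l), Function.Bijective (Fin.append J J') := by
  have hcard : (Finset.univ.map J.toEmbedding)ᶜ.card = l := by
    rw [Finset.card_compl, Finset.card_map, Finset.card_univ, Fintype.card_fin, Fintype.card_fin,
      Nat.add_sub_cancel_left]
  let J' := Finset.orderEmbOfFin _ hcard
  refine ⟨J', Finite.injective_iff_bijective.1 (Fin.append_injective_iff.2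
    ⟨J.injective, J'.injective, fun i j h => ?_⟩)⟩
  have hj := Finset.orderEmbOfFin_mem _ hcard j
  rw [Finset.mem_compl] at hj
  exact hj (h ▸ Finset.mem_map_of_mem J.toEmbedding (Finset.mem_univ i))

theorem orderEmbedding_eq_of_append_injective {J K : Fin k ↪o Fin (k + l)}
    {J' : Fin l → Fin (k + l)} (hJ : Function.Bijective (Fin.append J J'))
    (hK : Function.Injective (Fin.append K J')) : K = J := by
  refine OrderEmbedding.range_inj.1 (Set.eq_of_subset_of_ncard_le ?_ ?_)
  · rintro _ ⟨i, rfl⟩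
    obtain ⟨j, hj⟩ := hJ.2 (K i)
    induction j using Fin.addCases with
    | left j => exact ⟨j, by rw [← hj, Fin.append_left]⟩
    | right j =>
      rw [Fin.append_right] at hj
      exact ((Fin.append_injective_iff.1 hK).2.2 i j hj.symm).elim
  · rw [← Set.image_univ, ← Set.image_univ, Set.ncard_image_of_injective _ J.injective,
      Set.ncard_image_of_injective _ K.injective]

end Append

section LocalizedSpan

theorem exists_forall_smul_mem_of_finite {R M : Type*} [CommRing R] [AddCommGroup M] [Module R M]
    [Module.Finite R M] (S : Submonoid R) (N : Submodule R M) (h : ∀ x : M, ∃ t : S, t • x ∈ N) :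
    ∃ t : S, ∀ x : M, t • x ∈ N := by
  obtain ⟨n, g, hg⟩ := Module.Finite.exists_fin (R := R) (M := M)
  choose t ht using fun i => h (g i)
  have hspan : Submodule.span R (Set.range g) ≤
      N.comap (LinearMap.lsmul R M (∏ i, t i : S)) := by
    rw [Submodule.span_le]
    rintro _ ⟨i, rfl⟩
    change (∏ i, t i) • g i ∈ N
    rw [← Finset.prod_erase_mul _ _ (Finset.mem_univ i), mul_smul]
    exact N.smul_mem (∏ j ∈ Finset.univ.erase i, t j : S) (ht i)
  exact ⟨∏ i, t i, fun x => hspan (hg ▸ Submodule.mem_top)⟩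

variable {R : Type*} [CommRing R] (S : Submonoid R) (Rₛ : Type*) [CommRing Rₛ] [Algebra R Rₛ]
  [IsLocalization S Rₛ] {M M' : Type*} [AddCommGroup M] [Module R M] [AddCommGroup M']
  [Module R M'] [Module Rₛ M'] [IsScalarTower R Rₛ M'] (f : M →ₗ[R] M') [IsLocalizedModule S f]
  {ι : Type*} {a : ι → M}

theorem span_range_comp_eq_top_of_forall_smul_mem {t : S}
    (ht : ∀ x : M, t • x ∈ Submodule.span R (Set.range a)) :
    Submodule.span Rₛ (Set.range (f ∘ a)) = ⊤ := by
  rw [Set.range_comp, ← Submodule.localized'_span Rₛ S f, Submodule.eq_top_iff']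
  intro y
  obtain ⟨⟨x, s⟩, rfl⟩ := IsLocalizedModule.mk'_surjective S f y
  exact ⟨t • x, ht x, t * s, IsLocalizedModule.mk'_cancel_left ..⟩

theorem span_range_comp_eq_top_iff_exists_smul_mem [Module.Finite R M] :
    Submodule.span Rₛ (Set.range (f ∘ a)) = ⊤ ↔
      ∃ t : S, ∀ x : M, t • x ∈ Submodule.span R (Set.range a) := by
  refine ⟨fun h => exists_forall_smul_mem_of_finite S _ fun x => ?_,
    fun ⟨_, ht⟩ => span_range_comp_eq_top_of_forall_smul_mem S Rₛ f ht⟩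
  rw [Set.range_comp, ← Submodule.localized'_span Rₛ S f, Submodule.eq_top_iff'] at h
  obtain ⟨m, hm, s, hms⟩ := h (f x)
  rw [IsLocalizedModule.mk'_eq_iff, ← LinearMap.map_smul_of_tower] at hms
  obtain ⟨c, hc⟩ := IsLocalizedModule.exists_of_eq (S := S) hms
  refine ⟨c * s, ?_⟩
  rw [mul_smul, ← hc]
  exact Submodule.smul_mem _ (c : R) hm

theorem linearIndependent_comp_of_forall_exists_mul_eq_zero [Fintype ι]
    (h : ∀ c : ι → R, ∑ i, c i • a i = 0 → ∀ i, ∃ u ∈ S, u * c i = 0) :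
    LinearIndependent Rₛ (f ∘ a) := by
  rw [Fintype.linearIndependent_iff]
  intro g hg
  obtain ⟨s, hs⟩ := IsLocalization.exist_integer_multiples_of_finite S g
  choose c hc using hs
  have hsum : f (∑ i, c i • a i) = 0 := by
    simp only [map_sum, map_smul, ← algebraMap_smul Rₛ (c _), hc]
    simp only [Function.comp_apply] at hg
    simp only [smul_assoc, ← Finset.smul_sum, hg, smul_zero]
  obtain ⟨t, ht⟩ := (IsLocalizedModule.eq_zero_iff S f).1 hsum
  have ht' : ∑ i, (t * c i) • a i = 0 := by
    rw [← ht, Finset.smul_sum]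
    exact Finset.sum_congr rfl fun i _ => mul_smul _ _ _
  intro i
  obtain ⟨u, hu, huc⟩ := h _ ht' i
  have hzero : algebraMap R Rₛ (c i) = 0 := by
    refine (IsLocalization.map_eq_zero_iff S Rₛ _).2 ⟨⟨u, hu⟩ * t, ?_⟩
    rw [← huc, Submonoid.coe_mul, mul_assoc]
  rw [hc, Algebra.smul_def] at hzero
  exact ((IsLocalization.map_units Rₛ s).mul_right_eq_zero).1 hzero

end LocalizedSpan

section LocalizedModule

variable {R : Type*} [CommRing R] {S : Submonoid R} {M N : Type*} [AddCommGroup M] [Module R M]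
  [AddCommGroup N] [Module R N] {ι : Type*} [Fintype ι] {a : ι → M} {t : S}

theorem projective_localizedModule_of_forall_smul_mem
    (ht : ∀ x, t • x ∈ Submodule.span R (Set.range a))
    (h : ∀ c : ι → R, ∑ i, c i • a i = 0 → ∀ i, ∃ u ∈ S, u * c i = 0) :
    Module.Projective (Localization S) (LocalizedModule S M) :=
  .of_basis (Module.Basis.mk
    (linearIndependent_comp_of_forall_exists_mul_eq_zero S _ (LocalizedModule.mkLinearMap S M) h)
    (span_range_comp_eq_top_of_forall_smul_mem S _ _ ht).ge)

theorem localizedModule_map_injective_of_forall_smul_mem {f : M →ₗ[R] N}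
    (ht : ∀ x, t • x ∈ Submodule.span R (Set.range a))
    (h : ∀ c : ι → R, ∑ i, c i • f (a i) = 0 → ∀ i, ∃ u ∈ S, u * c i = 0) :
    Function.Injective (LocalizedModule.map S f) := by
  have hspan := span_range_comp_eq_top_of_forall_smul_mem S (Localization S)
    (LocalizedModule.mkLinearMap S M) ht
  have hindep := linearIndependent_comp_of_forall_exists_mul_eq_zero S (Localization S)
    (LocalizedModule.mkLinearMap S N) (a := f ∘ a) h
  have hcomp : LocalizedModule.map S f ∘ LocalizedModule.mkLinearMap S M ∘ a =
      LocalizedModule.mkLinearMap S N ∘ f ∘ a :=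
    funext fun i => LocalizedModule.map_mk S f (a i) 1
  rw [← hcomp] at hindep
  have hdisj := Submodule.range_ker_disjoint hindep
  rwa [hspan, top_disjoint, LinearMap.ker_eq_bot] at hdisj

end LocalizedModule

theorem span_range_eq_of_eq_isUnit_smul {R M ι : Type*} [Semiring R] [AddCommMonoid M] [Module R M]
    {w z : ι → M} {e : ι → R} (he : ∀ i, IsUnit (e i)) (hw : ∀ i, w i = e i • z i) :
    Submodule.span R (Set.range w) = Submodule.span R (Set.range z) := by
  refine le_antisymm (Submodule.span_le.2 ?_) (Submodule.span_le.2 ?_) <;> rintro _ ⟨i, rfl⟩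
  · exact (hw i).symm ▸ Submodule.smul_mem _ _ (Submodule.subset_span ⟨i, rfl⟩)
  · exact (Submodule.smul_mem_iff_of_isUnit _ (he i)).1
      (hw i ▸ Submodule.subset_span (Set.mem_range_self i))

section LocalizedBasis

variable {R M : Type*} [CommRing R] [AddCommGroup M] [Module R M]

theorem exists_basis_localizedModule [Module.Finite R M] [Module.Projective R M] (P : Ideal R)
    [P.IsPrime] : ∃ (n : ℕ) (m : Fin n → M)
      (b : Module.Basis (Fin n) (Localization.AtPrime P) (LocalizedModule P.primeCompl M)),
      ⇑b = LocalizedModule.mkLinearMap P.primeCompl M ∘ m := by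
  have : Module.Free (Localization.AtPrime P) (LocalizedModule P.primeCompl M) :=
    Module.free_of_flat_of_isLocalRing
  let b := Module.finBasis (Localization.AtPrime P) (LocalizedModule P.primeCompl M)
  choose ms hms using fun i =>
    IsLocalizedModule.surj P.primeCompl (LocalizedModule.mkLinearMap P.primeCompl M) (b i)
  refine ⟨_, fun i => (ms i).1,
    b.isUnitSMul fun i => IsLocalization.map_units (Localization.AtPrime P) (ms i).2,
    funext fun i => ?_⟩
  rw [Module.Basis.isUnitSMul_apply, algebraMap_smul]
  exact hms i

theorem exists_mul_eq_zero_of_smul_ιMulti_eq_zero (S : Submonoid R) {Rₛ M' : Type*} [CommRing Rₛ]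
    [Algebra R Rₛ] [IsLocalization S Rₛ] [AddCommGroup M'] [Module R M'] [Module Rₛ M']
    [IsScalarTower R Rₛ M'] (f : M →ₗ[R] M') {n : ℕ} {m : Fin n → M}
    (b : Module.Basis (Fin n) Rₛ M') (hb : ⇑b = f ∘ m) {c : R}
    (hc : c • exteriorPower.ιMulti R n m = 0) : ∃ u ∈ S, u * c = 0 := by
  let D : M [⋀^Fin n]→ₗ[R] Rₛ :=
    { (b.det.toMultilinearMap.restrictScalars R).compLinearMap fun _ => f with
      map_eq_zero_of_eq' := fun _ _ _ h hij => b.det.map_eq_zero_of_eq _ (congrArg f h) hij }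
  have hD : D m = 1 := (congrArg b.det hb.symm).trans b.det_self
  have h := congrArg (exteriorPower.alternatingMapLinearEquiv D) hc
  rw [map_smul, exteriorPower.alternatingMapLinearEquiv_apply_ιMulti, hD, map_zero,
    Algebra.smul_def, mul_one, IsLocalization.map_eq_zero_iff S] at h
  obtain ⟨u, hu⟩ := h
  exact ⟨u, u.2, hu⟩

end LocalizedBasis

namespace SuperRing

section Homogeneous

variable {A : Type u} [Ring A] (𝒜 : ZMod 2 → AddSubgroup A) [GradedRing 𝒜]

theorem coe_decompose_mul_of_right_mem {i : ZMod 2} (r : A) {x : A} (hx : x ∈ 𝒜 i) :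
    (DirectSum.decompose 𝒜 (r * x) i : A) = (DirectSum.decompose 𝒜 r 0 : A) * x := by
  have h := DirectSum.coe_decompose_mul_add_of_right_mem 𝒜 (i := 0) (a := r) hx
  rwa [zero_add] at h

variable [SuperCommutative 𝒜]

theorem coe_decompose_zero_add_one (x : A) :
    (DirectSum.decompose 𝒜 x 0 : A) + (DirectSum.decompose 𝒜 x 1 : A) = x :=
  (Fin.sum_univ_two fun i : ZMod 2 => (DirectSum.decompose 𝒜 x i : A)).symm.trans
    (sum_decompose 𝒜 x)

theorem coe_decompose_one_mul (x y : A) :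
    (DirectSum.decompose 𝒜 (x * y) 1 : A) =
      (DirectSum.decompose 𝒜 x 1 : A) * (DirectSum.decompose 𝒜 y 0 : A) +
      (DirectSum.decompose 𝒜 x 0 : A) * (DirectSum.decompose 𝒜 y 1 : A) := by
  conv_lhs => rw [← coe_decompose_zero_add_one 𝒜 y, mul_add, DirectSum.decompose_add,
    DirectSum.add_apply, AddSubgroup.coe_add]
  rw [DirectSum.coe_decompose_mul_of_right_mem_zero 𝒜 (SetLike.coe_mem _),
    coe_decompose_mul_of_right_mem 𝒜 _ (SetLike.coe_mem _)]

theorem decompose_mem_of_mem_span {i : ZMod 2} {N : Submodule (𝒜 0) A} (hN : N ≤ component 𝒜 i)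
    {x : A} (hx : x ∈ Ideal.span (N : Set A)) : (DirectSum.decompose 𝒜 x i : A) ∈ N := by
  induction hx using Submodule.closure_induction with
  | zero => simp
  | add x y _ _ hx hy =>
    rw [DirectSum.decompose_add, DirectSum.add_apply, AddSubgroup.coe_add]
    exact add_mem hx hy
  | smul_mem r x hx =>
    rw [smul_eq_mul, coe_decompose_mul_of_right_mem 𝒜 r (hN hx)]
    exact N.smul_mem (DirectSum.decompose 𝒜 r 0) hx

variable {𝒜} in
theorem IsNoetherianSuperRing.isNoetherian_component (hA : IsNoetherianSuperRing 𝒜) (i : ZMod 2) :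
    IsNoetherian (𝒜 0) (component 𝒜 i) := by
  have : WellFoundedGT (HomogeneousIdeal 𝒜) := hA
  rw [isNoetherian_iff']
  let F : Submodule (𝒜 0) (component 𝒜 i) → HomogeneousIdeal 𝒜 := fun N =>
    ⟨Ideal.span (N.map (component 𝒜 i).subtype : Set A), Ideal.homogeneous_span 𝒜 _ (by
      rintro _ ⟨x, _, rfl⟩
      exact ⟨i, x.2⟩)⟩
  have mem_F : ∀ N (x : component 𝒜 i), (x : A) ∈ (F N).toIdeal ↔ x ∈ N := by
    refine fun N x => ⟨fun hx => ?_, fun hx => Ideal.subset_span ⟨x, hx, rfl⟩⟩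
    have h := decompose_mem_of_mem_span 𝒜 (Submodule.map_subtype_le _ _) hx
    rw [DirectSum.decompose_of_mem_same 𝒜 x.2] at h
    exact (Function.Injective.mem_set_image (component 𝒜 i).injective_subtype).1 h
  refine StrictMono.wellFoundedGT (f := F) (Monotone.strictMono_of_injective ?_ ?_)
  · exact fun N N' h => Ideal.span_mono (Set.image_mono h)
  · exact fun N N' h => Submodule.ext fun x => by rw [← mem_F, h, mem_F]

variable {𝒜} in
theorem IsNoetherianSuperRing.isNoetherianRing_even (hA : IsNoetherianSuperRing 𝒜) :
    IsNoetherianRing (𝒜 0) :=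
  have := hA.isNoetherian_component 0
  isNoetherian_of_linearEquiv ({ AddEquiv.refl (𝒜 0) with map_smul' := fun _ _ => rfl } :
    component 𝒜 0 ≃ₗ[𝒜 0] 𝒜 0)

end Homogeneous

section OddIdeal

variable {A : Type u} [Ring A] (𝒜 : ZMod 2 → AddSubgroup A)

theorem odd_mem_oddIdeal {x : A} (hx : x ∈ 𝒜 1) : x ∈ oddIdeal 𝒜 := Ideal.subset_span hx

variable [GradedRing 𝒜] [SuperCommutative 𝒜]

theorem odd_mul_mul_self {x : A} (hx : x ∈ 𝒜 1) (r : A) : x * r * x = 0 := by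
  obtain ⟨e, he, o, ho, rfl⟩ := exists_even_add_odd 𝒜 r
  rw [mul_add, ← even_comm 𝒜 he, odd_anticomm 𝒜 hx ho, add_mul, neg_mul, mul_assoc, mul_assoc,
    SuperCommutative.odd_mul_self (𝒜 := 𝒜) x hx, mul_zero, mul_zero, neg_zero, add_zero]

theorem decompose_zero_mem_oddIdeal_sq {x : A} (hx : x ∈ oddIdeal 𝒜) :
    (DirectSum.decompose 𝒜 x 0 : A) ∈ oddIdeal 𝒜 ^ 2 := by
  induction hx using Submodule.closure_induction with
  | zero => simp
  | add x y _ _ hx hy =>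
    rw [DirectSum.decompose_add, DirectSum.add_apply, AddSubgroup.coe_add]
    exact add_mem hx hy
  | smul_mem r x hx =>
    have h : (DirectSum.decompose 𝒜 (r * x) 0 : A) = (DirectSum.decompose 𝒜 r 1 : A) * x :=
      DirectSum.coe_decompose_mul_add_of_right_mem 𝒜 (i := 1) hx
    rw [smul_eq_mul, h, Ideal.IsTwoSided.pow_succ, Submodule.pow_one]
    exact Ideal.mul_mem_mul (odd_mem_oddIdeal 𝒜 (SetLike.coe_mem _)) (odd_mem_oddIdeal 𝒜 hx)

theorem pow_mem_oddIdeal_pow {x : A} (hx : x ∈ oddIdeal 𝒜) (n : ℕ) : x ^ n ∈ oddIdeal 𝒜 ^ n := by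
  induction n with
  | zero => rw [Submodule.pow_zero, Ideal.one_eq_top]; trivial
  | succ n ih =>
    rw [pow_succ', Ideal.IsTwoSided.pow_succ]
    exact Ideal.mul_mem_mul hx ih

/-- The ring homomorphism `A₀ → A / I_A`, through which `A / I_A` is studied as a quotient of a
commutative ring. -/
def evenToBody : 𝒜 0 →+* Body 𝒜 :=
  (Ideal.Quotient.mk (oddIdeal 𝒜)).comp (algebraMap (𝒜 0) A)

theorem evenToBody_surjective : Function.Surjective (evenToBody 𝒜) := body_exists_even 𝒜

theorem evenToBody_eq_zero_iff {x : 𝒜 0} : evenToBody 𝒜 x = 0 ↔ (x : A) ∈ oddIdeal 𝒜 :=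
  Ideal.Quotient.eq_zero_iff_mem

theorem mk_eq_evenToBody (x : A) :
    Ideal.Quotient.mk (oddIdeal 𝒜) x = evenToBody 𝒜 (DirectSum.decompose 𝒜 x 0) := by
  conv_lhs => rw [← coe_decompose_zero_add_one 𝒜 x, map_add,
    Ideal.Quotient.eq_zero_iff_mem.2 (odd_mem_oddIdeal 𝒜 (SetLike.coe_mem _)), add_zero]
  rfl

theorem isNoetherianRing_body [IsNoetherianRing (𝒜 0)] : IsNoetherianRing (Body 𝒜) :=
  isNoetherianRing_of_surjective _ _ _ (evenToBody_surjective 𝒜)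

end OddIdeal

section OddProduct

variable {A : Type u} [Ring A] (𝒜 : ZMod 2 → AddSubgroup A) [GradedRing 𝒜] [SuperCommutative 𝒜]

/-- The product `x₁ ⋯ xₙ` of odd elements, as an alternating map over the even part. -/
noncomputable def oddProduct (n : ℕ) : component 𝒜 1 [⋀^Fin n]→ₗ[𝒜 0] A :=
  (ExteriorAlgebra.lift (𝒜 0) ⟨(component 𝒜 1).subtype,
    fun m => SuperCommutative.odd_mul_self (𝒜 := 𝒜) _ m.2⟩).toLinearMap.compAlternatingMap
    (ExteriorAlgebra.ιMulti (𝒜 0) n)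

theorem oddProduct_apply {n : ℕ} (v : Fin n → component 𝒜 1) :
    oddProduct 𝒜 n v = (List.ofFn fun i => (v i : A)).prod := by
  simp [oddProduct, ExteriorAlgebra.ιMulti_apply, map_list_prod, List.map_ofFn, Function.comp_def]

theorem oddProduct_cons {n : ℕ} (x : component 𝒜 1) (v : Fin n → component 𝒜 1) :
    oddProduct 𝒜 (n + 1) (Fin.cons x v) = x * oddProduct 𝒜 n v := by
  simp only [oddProduct_apply, List.ofFn_succ, List.prod_cons, Fin.cons_zero, Fin.cons_succ]

theorem oddIdeal_pow_eq_span (n : ℕ) :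
    oddIdeal 𝒜 ^ n = Ideal.span (Set.range (oddProduct 𝒜 n)) := by
  induction n with
  | zero =>
    rw [Submodule.pow_zero, Ideal.one_eq_top, eq_comm, Ideal.eq_top_iff_one]
    exact Ideal.subset_span ⟨Fin.elim0, by simp [oddProduct_apply]⟩
  | succ n ih =>
    have : (Ideal.span (𝒜 1 : Set A)).IsTwoSided := oddIdeal_isTwoSided 𝒜
    rw [Ideal.IsTwoSided.pow_succ, ih, oddIdeal, Ideal.span_mul_span']
    congr 1
    ext z
    constructor
    · rintro ⟨x, hx, _, ⟨v, rfl⟩, rfl⟩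
      exact ⟨Fin.cons ⟨x, hx⟩ v, oddProduct_cons 𝒜 _ _⟩
    · rintro ⟨v, rfl⟩
      rw [← Fin.cons_self_tail v, oddProduct_cons]
      exact ⟨_, (v 0).2, _, ⟨Fin.tail v, rfl⟩, rfl⟩

variable {𝒜}

theorem pow_smul_eq_zero_of_mem_oddIdeal_pow {s n : ℕ} (hsn : s < n) {a : Fin s → component 𝒜 1}
    {t : 𝒜 0} (ht : ∀ x, t • x ∈ Submodule.span (𝒜 0) (Set.range a)) {x : A}
    (hx : x ∈ oddIdeal 𝒜 ^ n) : t ^ n • x = 0 := by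
  rw [oddIdeal_pow_eq_span] at hx
  induction hx using Submodule.closure_induction with
  | zero => exact smul_zero _
  | add x y _ _ hx hy => rw [smul_add, hx, hy, add_zero]
  | smul_mem r x hx =>
    obtain ⟨v, rfl⟩ := hx
    have h : oddProduct 𝒜 n (fun i => t • v i) = 0 :=
      alternatingMap_eq_zero_of_mem_span _ hsn fun i => ht (v i)
    have hsmul := (oddProduct 𝒜 n).toMultilinearMap.map_smul_univ (fun _ => t) v
    rw [Finset.prod_const, Finset.card_univ, Fintype.card_fin] at hsmul
    rw [smul_eq_mul, ← mul_smul_comm]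
    exact (congrArg (r * ·) (hsmul.symm.trans h)).trans (mul_zero r)

variable (𝒜) [Module.Finite (𝒜 0) (component 𝒜 1)]

theorem exists_oddIdeal_pow_eq_bot : ∃ n, oddIdeal 𝒜 ^ n = ⊥ := by
  obtain ⟨s, a, ha⟩ := Module.Finite.exists_fin (R := 𝒜 0) (M := component 𝒜 1)
  refine ⟨s + 1, (Submodule.eq_bot_iff _).2 fun x hx => ?_⟩
  have h := pow_smul_eq_zero_of_mem_oddIdeal_pow (Nat.lt_succ_self s) (t := 1)
    (fun y => ha ▸ Submodule.mem_top) hx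
  rwa [one_pow, one_smul] at h

theorem ker_evenToBody_le_nilradical : RingHom.ker (evenToBody 𝒜) ≤ nilradical (𝒜 0) := by
  intro x hx
  obtain ⟨n, hn⟩ := exists_oddIdeal_pow_eq_bot 𝒜
  have h := pow_mem_oddIdeal_pow 𝒜 ((evenToBody_eq_zero_iff 𝒜).1 hx) n
  rw [hn, Submodule.mem_bot] at h
  exact ⟨n, Subtype.ext h⟩

theorem ringKrullDim_even_eq_body : ringKrullDim (𝒜 0) = ringKrullDim (Body 𝒜) :=
  (ringKrullDim_quotient_eq_of_le_nilradical (ker_evenToBody_le_nilradical 𝒜)).symm.trans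
    (ringKrullDim_eq_of_ringEquiv
      (RingHom.quotientKerEquivOfSurjective (evenToBody_surjective 𝒜)))

theorem ker_evenToBody_eq_nilradical [IsReduced (Body 𝒜)] :
    RingHom.ker (evenToBody 𝒜) = nilradical (𝒜 0) :=
  (ker_evenToBody_le_nilradical 𝒜).antisymm fun _ hx =>
    (IsNilpotent.map (mem_nilradical.1 hx) (evenToBody 𝒜)).eq_zero

end OddProduct

section BodyComap

variable {R : Type u} [Ring R] (𝓡 : ZMod 2 → AddSubgroup R) [GradedRing 𝓡] [SuperCommutative 𝓡]

/-- The super-ideal of `R` that is the preimage of an ideal of `R / I_R`. -/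
def bodyComap (P : Ideal (Body 𝓡)) : HomogeneousIdeal 𝓡 where
  toSubmodule := P.comap (Ideal.Quotient.mk (oddIdeal 𝓡))
  is_homogeneous' i x hx := by
    have hzmod : ∀ k : ZMod 2, k = 0 ∨ k = 1 := by decide
    rcases hzmod i with rfl | rfl
    · rwa [Ideal.mem_comap, mk_eq_evenToBody] at hx
    · rw [Ideal.mem_comap, Ideal.Quotient.eq_zero_iff_mem.2
        (odd_mem_oddIdeal 𝓡 (SetLike.coe_mem _))]
      exact zero_mem P

variable (P : Ideal (Body 𝓡))

theorem mem_bodyComap {x : R} :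
    x ∈ (bodyComap 𝓡 P).toIdeal ↔ Ideal.Quotient.mk (oddIdeal 𝓡) x ∈ P := Iff.rfl

theorem evenPart_bodyComap : evenPart 𝓡 (bodyComap 𝓡 P) = P.comap (evenToBody 𝓡) := rfl

theorem oddIdeal_le_bodyComap : oddIdeal 𝓡 ≤ (bodyComap 𝓡 P).toIdeal := fun x hx => by
  rw [mem_bodyComap, Ideal.Quotient.eq_zero_iff_mem.2 hx]
  exact zero_mem P

instance bodyComap_isPrime [hP : P.IsPrime] : (bodyComap 𝓡 P).toIdeal.IsPrime where
  ne_top' h := hP.ne_top ((Ideal.eq_top_iff_one _).2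
    (show (1 : R) ∈ (bodyComap 𝓡 P).toIdeal from h ▸ trivial))
  mem_or_mem' {x y} h := by
    rw [mem_bodyComap, map_mul] at h
    exact hP.mem_or_mem h

theorem bodyComap_isMaximal [P.IsMaximal] : (bodyComap 𝓡 P).toIdeal.IsMaximal :=
  Ideal.comap_isMaximal_of_surjective (Ideal.Quotient.mk (oddIdeal 𝓡)) Ideal.Quotient.mk_surjective

theorem exists_eq_bodyComap {𝔫 : HomogeneousIdeal 𝓡} (h : ∀ x ∈ 𝓡 1, x ∈ 𝔫.toIdeal) :
    ∃ P : Ideal (Body 𝓡), 𝔫 = bodyComap 𝓡 P := by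
  refine ⟨𝔫.toIdeal.map (Ideal.Quotient.mk (oddIdeal 𝓡)),
    HomogeneousIdeal.ext (Ideal.ext fun x => ?_)⟩
  rw [mem_bodyComap, Ideal.mem_map_iff_of_surjective _ Ideal.Quotient.mk_surjective]
  refine ⟨fun hx => ⟨x, hx, rfl⟩, fun ⟨y, hy, hyx⟩ => ?_⟩
  have hle : oddIdeal 𝓡 ≤ 𝔫.toIdeal := Ideal.span_le.2 h
  have hxy := hle (Ideal.Quotient.eq.1 hyx.symm)
  simpa only [sub_add_cancel] using add_mem hxy hy

theorem odd_mem_of_isPrime {𝔭 : HomogeneousIdeal 𝓡} [h : 𝔭.toIdeal.IsPrime] {x : R}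
    (hx : x ∈ 𝓡 1) : x ∈ 𝔭.toIdeal :=
  or_self_iff.1 (h.mem_or_mem (by
    rw [SuperCommutative.odd_mul_self (𝒜 := 𝓡) x hx]; exact zero_mem _))

theorem odd_mem_of_isMaximal {𝔫 : Ideal R} (h : 𝔫.IsMaximal) {x : R} (hx : x ∈ 𝓡 1) :
    x ∈ 𝔫 := by
  by_contra hxn
  obtain ⟨r, n, hn, hrx⟩ := h.exists_inv hxn
  -- `r x` squares to zero, so `n = 1 - r x` is a unit.
  have hunit : (1 + r * x) * n = 1 := by
    rw [eq_sub_of_add_eq' hrx, mul_sub, mul_one, add_mul, one_mul, mul_assoc, ← mul_assoc x,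
      odd_mul_mul_self 𝓡 hx, mul_zero, add_zero, add_sub_cancel_right]
  exact h.ne_top ((Ideal.eq_top_iff_one _).2 (hunit ▸ 𝔫.mul_mem_left _ hn))

theorem isLocalWith_iff [IsLocalRing (Body 𝓡)] {𝔪 : HomogeneousIdeal 𝓡} :
    IsLocalWith 𝓡 𝔪 ↔ 𝔪 = bodyComap 𝓡 (IsLocalRing.maximalIdeal (Body 𝓡)) := by
  have hmax := bodyComap_isMaximal 𝓡 (IsLocalRing.maximalIdeal (Body 𝓡))
  refine ⟨fun h => ((h _).1 hmax).symm, ?_⟩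
  rintro rfl 𝔫
  refine ⟨fun h => ?_, fun h => h ▸ hmax⟩
  obtain ⟨P, rfl⟩ := exists_eq_bodyComap 𝓡 fun x hx => odd_mem_of_isMaximal 𝓡 h hx
  have hP : P ≠ ⊤ := fun hP => h.ne_top (hP ▸ Ideal.comap_top)
  exact HomogeneousIdeal.ext
    (h.eq_of_le hmax.ne_top (Ideal.comap_mono (IsLocalRing.le_maximalIdeal hP)))

theorem evenPart_bodyComap_maximalIdeal [IsLocalRing (𝓡 0)] [IsLocalRing (Body 𝓡)] :
    evenPart 𝓡 (bodyComap 𝓡 (IsLocalRing.maximalIdeal (Body 𝓡))) =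
      IsLocalRing.maximalIdeal (𝓡 0) := by
  rw [evenPart_bodyComap]
  exact IsLocalRing.eq_maximalIdeal
    (Ideal.comap_isMaximal_of_surjective _ (evenToBody_surjective 𝓡))

end BodyComap

section Cotangent

variable {R : Type u} [Ring R] (𝓡 : ZMod 2 → AddSubgroup R) [GradedRing 𝓡] [SuperCommutative 𝓡]

theorem coe_mem_sq_of_mem_evenPart_sq {𝔪 : HomogeneousIdeal 𝓡} {x : 𝓡 0}
    (hx : x ∈ evenPart 𝓡 𝔪 ^ 2) : (x : R) ∈ 𝔪.toIdeal ^ 2 := by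
  rw [pow_two] at hx
  rw [Submodule.pow_succ, Submodule.pow_one]
  induction hx using Submodule.smul_induction_on' with
  | smul a ha b hb => exact Ideal.mul_mem_mul (I := 𝔪.toIdeal) (J := 𝔪.toIdeal) ha hb
  | add a _ b _ ha hb => exact add_mem ha hb

theorem even_mem_bodyComap_sq_iff {P : Ideal (Body 𝓡)} {x : 𝓡 0} :
    (x : R) ∈ (bodyComap 𝓡 P).toIdeal ^ 2 ↔ evenToBody 𝓡 x ∈ P ^ 2 := by
  constructor
  · suffices h : ∀ y ∈ (bodyComap 𝓡 P).toIdeal ^ 2, Ideal.Quotient.mk (oddIdeal 𝓡) y ∈ P ^ 2 from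
      h x
    intro y hy
    rw [Submodule.pow_succ, Submodule.pow_one] at hy
    induction hy using Submodule.smul_induction_on' with
    | smul a ha b hb =>
      rw [smul_eq_mul, map_mul, pow_two]
      exact Ideal.mul_mem_mul ha hb
    | add a _ b _ ha hb => rw [map_add]; exact add_mem ha hb
  · intro hx
    rw [← Ideal.map_comap_of_surjective _ (evenToBody_surjective 𝓡) P, ← Ideal.map_pow,
      Ideal.mem_map_iff_of_surjective _ (evenToBody_surjective 𝓡)] at hx
    obtain ⟨y, hy, hyx⟩ := hx
    have hodd : ((x - y : 𝓡 0) : R) ∈ oddIdeal 𝓡 :=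
      (evenToBody_eq_zero_iff 𝓡).1 (by rw [map_sub, hyx, sub_self])
    have hsq := decompose_zero_mem_oddIdeal_sq 𝓡 hodd
    rw [DirectSum.decompose_of_mem_same 𝓡 (x - y).2] at hsq
    have h := add_mem (Ideal.pow_right_mono (oddIdeal_le_bodyComap 𝓡 P) 2 hsq)
      (coe_mem_sq_of_mem_evenPart_sq 𝓡 (𝔪 := bodyComap 𝓡 P) hy)
    rwa [AddSubgroup.coe_sub, sub_add_cancel] at h

/-- The comparison `𝔪₀ → P / P²` of even cotangent spaces, where `𝔪` is the preimage of an ideal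
`P` of `R / I_R`. -/
noncomputable def evenToCotangent (P : Ideal (Body 𝓡)) :
    idealComponent 𝓡 (bodyComap 𝓡 P) 0 →ₛₗ[evenToBody 𝓡] P.Cotangent where
  toFun x := P.toCotangent ⟨Ideal.Quotient.mk (oddIdeal 𝓡) (x : R), x.2.1⟩
  map_add' _ _ := (map_add P.toCotangent _ _).symm ▸ rfl
  map_smul' _ _ := (map_smul P.toCotangent _ _).symm ▸ rfl

theorem evenToCotangent_surjective (P : Ideal (Body 𝓡)) :
    Function.Surjective (evenToCotangent 𝓡 P) := fun c => by
  obtain ⟨⟨b, hb⟩, rfl⟩ := P.toCotangent_surjective c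
  obtain ⟨e, rfl⟩ := body_exists_even 𝓡 b
  exact ⟨⟨(e : R), hb, e.2⟩, rfl⟩

theorem ker_evenToCotangent (P : Ideal (Body 𝓡)) : LinearMap.ker (evenToCotangent 𝓡 P) =
    Submodule.submoduleOf (((bodyComap 𝓡 P).toIdeal ^ 2).restrictScalars (𝓡 0))
      (idealComponent 𝓡 (bodyComap 𝓡 P) 0) :=
  Submodule.ext fun x => LinearMap.mem_ker.trans <| (Ideal.toCotangent_eq_zero _ _).trans
    (even_mem_bodyComap_sq_iff 𝓡 (x := ⟨x, x.2.2⟩)).symm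

theorem rank_cotangent_bodyComap_zero (P : Ideal (Body 𝓡)) :
    Module.rank (Residue 𝓡 (bodyComap 𝓡 P)) (Cotangent 𝓡 (bodyComap 𝓡 P) 0) =
      Module.rank (Body 𝓡 ⧸ P) P.Cotangent := by
  let i : Residue 𝓡 (bodyComap 𝓡 P) →+* Body 𝓡 ⧸ P := Ideal.quotientMap P (evenToBody 𝓡) le_rfl
  have hi : Function.Bijective i := ⟨Ideal.quotientMap_injective' le_rfl,
    Ideal.quotientMap_surjective (evenToBody_surjective 𝓡)⟩
  let j : Cotangent 𝓡 (bodyComap 𝓡 P) 0 →ₛₗ[evenToBody 𝓡] P.Cotangent :=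
    Submodule.liftQ _ (evenToCotangent 𝓡 P) (ker_evenToCotangent 𝓡 P).ge
  have hj : Function.Bijective j :=
    ⟨LinearMap.ker_eq_bot.1 (Submodule.ker_liftQ_eq_bot _ _ _ (ker_evenToCotangent 𝓡 P).le),
      fun c => (evenToCotangent_surjective 𝓡 P c).imp' (Submodule.Quotient.mk ·) fun _ h => h⟩
  refine rank_eq_of_equiv_equiv i (AddEquiv.ofBijective j hj) hi fun r c => ?_
  obtain ⟨r, rfl⟩ := Ideal.Quotient.mk_surjective r
  exact j.map_smulₛₗ r c

theorem cotangentDim_zero_eq [IsLocalRing (Body 𝓡)] [IsNoetherianRing (Body 𝓡)] :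
    cotangentDim 𝓡 (bodyComap 𝓡 (IsLocalRing.maximalIdeal (Body 𝓡))) 0 =
      (IsLocalRing.maximalIdeal (Body 𝓡)).spanFinrank := by
  rw [IsLocalRing.spanFinrank_maximalIdeal_eq_finrank_cotangentSpace, cotangentDim,
    rank_cotangent_bodyComap_zero]
  change Cardinal.toENat
    (Module.rank (IsLocalRing.ResidueField (Body 𝓡)) (IsLocalRing.CotangentSpace (Body 𝓡))) = _
  rw [← Module.finrank_eq_rank, Cardinal.toENat_nat]

theorem decompose_one_mem_smul_of_mem_sq {𝔪 : HomogeneousIdeal 𝓡} {x : R}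
    (hx : x ∈ 𝔪.toIdeal ^ 2) :
    (DirectSum.decompose 𝓡 x 1 : R) ∈ evenPart 𝓡 𝔪 • component 𝓡 1 := by
  rw [Submodule.pow_succ, Submodule.pow_one] at hx
  induction hx using Submodule.smul_induction_on' with
  | smul a ha b hb =>
    rw [smul_eq_mul, coe_decompose_one_mul, ← even_comm 𝓡 (SetLike.coe_mem _)]
    exact add_mem (Submodule.smul_mem_smul (𝔪.is_homogeneous' 0 hb) (SetLike.coe_mem _))
      (Submodule.smul_mem_smul (𝔪.is_homogeneous' 0 ha) (SetLike.coe_mem _))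
  | add a _ b _ ha hb =>
    rw [DirectSum.decompose_add, DirectSum.add_apply, AddSubgroup.coe_add]
    exact add_mem ha hb

theorem odd_mem_bodyComap_sq_iff {P : Ideal (Body 𝓡)} {x : component 𝓡 1} :
    (x : R) ∈ (bodyComap 𝓡 P).toIdeal ^ 2 ↔
      x ∈ (evenPart 𝓡 (bodyComap 𝓡 P) • ⊤ : Submodule (𝓡 0) (component 𝓡 1)) := by
  have hmap : (evenPart 𝓡 (bodyComap 𝓡 P) • ⊤ : Submodule (𝓡 0) (component 𝓡 1)).map
      (component 𝓡 1).subtype = evenPart 𝓡 (bodyComap 𝓡 P) • component 𝓡 1 := by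
    rw [Submodule.map_smul'', Submodule.map_subtype_top]
  refine Iff.trans ?_ (Function.Injective.mem_set_image (component 𝓡 1).injective_subtype)
  rw [← Submodule.map_coe, hmap, SetLike.mem_coe, Submodule.subtype_apply]
  refine ⟨fun h => ?_, fun h => ?_⟩
  · simpa only [DirectSum.decompose_of_mem_same 𝓡 x.2] using decompose_one_mem_smul_of_mem_sq 𝓡 h
  · refine (Submodule.smul_le (P := ((bodyComap 𝓡 P).toIdeal ^ 2).restrictScalars (𝓡 0))).2
      (fun r hr y hy => ?_) h
    rw [Submodule.pow_succ, Submodule.pow_one]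
    exact Ideal.mul_mem_mul (I := (bodyComap 𝓡 P).toIdeal) (J := (bodyComap 𝓡 P).toIdeal) hr
      (oddIdeal_le_bodyComap 𝓡 P (odd_mem_oddIdeal 𝓡 hy))

theorem idealComponent_bodyComap_one (P : Ideal (Body 𝓡)) :
    idealComponent 𝓡 (bodyComap 𝓡 P) 1 = component 𝓡 1 :=
  inf_eq_right.2 fun _ hx => oddIdeal_le_bodyComap 𝓡 P (odd_mem_oddIdeal 𝓡 hx)

/-- The identification of `(𝔪 / 𝔪²)₁` with `R₁ / 𝔪₀ R₁`, where `𝔪` is the preimage of an ideal of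
`R / I_R`. -/
noncomputable def oddCotangentEquiv (P : Ideal (Body 𝓡)) : Cotangent 𝓡 (bodyComap 𝓡 P) 1 ≃ₗ[𝓡 0]
    component 𝓡 1 ⧸ (evenPart 𝓡 (bodyComap 𝓡 P) • ⊤ : Submodule (𝓡 0) (component 𝓡 1)) :=
  Submodule.Quotient.equiv _ _ (LinearEquiv.ofEq _ _ (idealComponent_bodyComap_one 𝓡 P)) <| by
    ext x
    rw [← odd_mem_bodyComap_sq_iff, Submodule.mem_map_equiv]
    rfl

theorem cotangentDim_one_eq [IsLocalRing (𝓡 0)] [IsLocalRing (Body 𝓡)]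
    [Module.Finite (𝓡 0) (component 𝓡 1)] :
    cotangentDim 𝓡 (bodyComap 𝓡 (IsLocalRing.maximalIdeal (Body 𝓡))) 1 =
      (component 𝓡 1).spanFinrank := by
  let 𝔪 := IsLocalRing.maximalIdeal (𝓡 0)
  let j := oddCotangentEquiv 𝓡 (IsLocalRing.maximalIdeal (Body 𝓡)) ≪≫ₗ
    Submodule.quotEquivOfEq _ (𝔪 • ⊤) (by rw [evenPart_bodyComap_maximalIdeal])
  have hrank := rank_eq_of_equiv_equiv
    (Ideal.quotEquivOfEq (evenPart_bodyComap_maximalIdeal 𝓡)) j.toAddEquiv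
    (Ideal.quotEquivOfEq _).bijective fun r c => by
      obtain ⟨r, rfl⟩ := Ideal.Quotient.mk_surjective r
      exact j.map_smul r c
  have : Module.Finite (𝓡 0 ⧸ 𝔪) (component 𝓡 1 ⧸ (𝔪 • ⊤ : Submodule (𝓡 0) (component 𝓡 1))) :=
    Module.Finite.of_restrictScalars_finite (𝓡 0) _ _
  let := Ideal.Quotient.field 𝔪
  rw [IsLocalRing.spanFinrank_eq_finrank_quotient _ (Module.Finite.iff_fg.1 ‹_›), cotangentDim,
    hrank, ← Module.finrank_eq_rank, Cardinal.toENat_nat]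

end Cotangent

section RegularLocal

variable {R : Type u} [Ring R] (𝓡 : ZMod 2 → AddSubgroup R) [GradedRing 𝓡] [SuperCommutative 𝓡]

/-- The odd part has generators `z₁, …, zₛ` such that `Ann(z₁ ⋯ zₛ)` dies in the body. For a
super-ring whose body is a regular local ring, this is the odd half of regularity: the minimal
number of odd generators is the odd Krull dimension. -/
def HasFreeOddGenerators : Prop :=
  ∃ (s : ℕ) (z : Fin s → component 𝓡 1), Submodule.span (𝓡 0) (Set.range z) = ⊤ ∧
    evenAnn 𝓡 (oddProduct 𝓡 s z) ≤ RingHom.ker (evenToBody 𝓡)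

theorem exists_isOddParameterSystem_zero : ∃ y : Fin 0 → R, IsOddParameterSystem 𝓡 y := by
  have hann : evenAnn 𝓡 (1 : R) = ⊥ :=
    (Submodule.eq_bot_iff _).2 fun x hx => Subtype.ext ((mul_one (x : R)).symm.trans hx)
  refine ⟨Fin.elim0, fun i => i.elim0, ?_⟩
  rw [List.ofFn_zero, List.prod_nil, hann]
  exact (ringKrullDim_eq_of_ringEquiv (RingEquiv.quotientBot (𝓡 0))).symm

theorem exists_isOddParameterSystem {s : ℕ} (h : oddKrullDim 𝓡 = s) :
    ∃ y : Fin s → R, IsOddParameterSystem 𝓡 y := by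
  rw [oddKrullDim, iSup_subtype'] at h
  have : Nonempty {n : ℕ // ∃ y : Fin n → R, IsOddParameterSystem 𝓡 y} :=
    ⟨⟨0, exists_isOddParameterSystem_zero 𝓡⟩⟩
  obtain ⟨⟨n, hn⟩, hns⟩ := ENat.exists_eq_iSup_of_lt_top (h ▸ ENat.natCast_lt_top s)
  obtain rfl : n = s := Nat.cast_injective (hns.trans h)
  exact hn

theorem oddKrullDim_le_of_span_range_eq_top [Nontrivial (𝓡 0)] {s : ℕ}
    {a : Fin s → component 𝓡 1} (ha : Submodule.span (𝓡 0) (Set.range a) = ⊤) :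
    oddKrullDim 𝓡 ≤ s := by
  refine iSup₂_le fun n ⟨y, hy, hdim⟩ => Nat.cast_le.2 (not_lt.1 fun hsn => ?_)
  have hprod : oddProduct 𝓡 n (fun i => ⟨y i, hy i⟩) = 0 :=
    alternatingMap_eq_zero_of_mem_span _ hsn fun i => ha ▸ Submodule.mem_top
  rw [oddProduct_apply] at hprod
  have hann : evenAnn 𝓡 (List.ofFn y).prod = ⊤ :=
    Ideal.eq_top_iff_one _ |>.2 ((congrArg _ hprod).trans (mul_zero _))
  have : Subsingleton (𝓡 0 ⧸ evenAnn 𝓡 (List.ofFn y).prod) :=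
    Ideal.Quotient.subsingleton_iff.2 hann
  rw [ringKrullDim_eq_bot_of_subsingleton (R := 𝓡 0 ⧸ _)] at hdim
  exact Order.krullDim_ne_bot_iff.2 inferInstance hdim

variable [Module.Finite (𝓡 0) (component 𝓡 1)]

theorem exists_isOddParameterSystem_iff [FiniteRingKrullDim (𝓡 0)] [IsDomain (Body 𝓡)] {s : ℕ} :
    (∃ y : Fin s → R, IsOddParameterSystem 𝓡 y) ↔
      ∃ z : Fin s → component 𝓡 1, evenAnn 𝓡 (oddProduct 𝓡 s z) ≤ RingHom.ker (evenToBody 𝓡) := by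
  have hker := ker_evenToBody_eq_nilradical 𝓡
  have hprime : (nilradical (𝓡 0)).IsPrime := hker ▸ RingHom.ker_isPrime _
  have hdim (z : Fin s → component 𝓡 1) :
      ringKrullDim (𝓡 0) = ringKrullDim (𝓡 0 ⧸ evenAnn 𝓡 (List.ofFn fun i => (z i : R)).prod) ↔
        evenAnn 𝓡 (oddProduct 𝓡 s z) ≤ RingHom.ker (evenToBody 𝓡) := by
    rw [hker, ← ringKrullDim_quotient_eq_iff_le_nilradical hprime, oddProduct_apply, eq_comm]
  constructor
  · rintro ⟨y, hy, h⟩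
    exact ⟨fun i => ⟨y i, hy i⟩, (hdim _).1 h⟩
  · rintro ⟨z, hz⟩
    exact ⟨fun i => z i, fun i => (z i).2, (hdim z).2 hz⟩

theorem oddKrullDim_eq_spanFinrank_iff [FiniteRingKrullDim (𝓡 0)] [IsDomain (Body 𝓡)] :
    oddKrullDim 𝓡 = (component 𝓡 1).spanFinrank ↔ HasFreeOddGenerators 𝓡 := by
  have : Nontrivial (𝓡 0) := (evenToBody 𝓡).domain_nontrivial
  obtain ⟨a, ha⟩ := exists_fin_spanFinrank_span_range_eq_top (𝓡 0) (component 𝓡 1)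
  rw [← Submodule.spanFinrank_top]
  constructor
  · intro h
    obtain ⟨z, hz⟩ := (exists_isOddParameterSystem_iff 𝓡).1 (exists_isOddParameterSystem 𝓡 h)
    obtain ⟨b, hb⟩ := Submodule.mem_span_singleton.1 <|
      alternatingMap_mem_span_singleton (oddProduct 𝓡 _) (a := a) (v := z)
        fun i => ha.symm ▸ Submodule.mem_top
    refine ⟨_, a, ha, fun c hc => hz ?_⟩
    change c • oddProduct 𝓡 _ z = 0
    rw [← hb, smul_comm, show c • oddProduct 𝓡 _ a = 0 from hc, smul_zero]
  · rintro ⟨s, z, hspan, hz⟩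
    refine le_antisymm (oddKrullDim_le_of_span_range_eq_top 𝓡 ha) ?_
    exact (Nat.cast_le.2 (spanFinrank_top_le_of_span_range_eq_top hspan)).trans
      (le_iSup₂_of_le (f := fun (n : ℕ) (_ : ∃ y : Fin n → R, IsOddParameterSystem 𝓡 y) =>
        (n : ℕ∞)) s ((exists_isOddParameterSystem_iff 𝓡).2 ⟨z, hz⟩) le_rfl)

theorem isRegularLocal_iff [IsLocalRing (𝓡 0)] [IsNoetherianRing (𝓡 0)] :
    IsRegularLocal 𝓡 ↔ IsRegularLocalRing (Body 𝓡) ∧ HasFreeOddGenerators 𝓡 := by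
  have : Nontrivial (Body 𝓡) := by
    rw [← PrimeSpectrum.nonempty_iff_nontrivial, ← Order.krullDim_ne_bot_iff]
    exact (ringKrullDim_even_eq_body 𝓡).symm.trans_ne (Order.krullDim_ne_bot_iff.2 inferInstance)
  have : IsLocalRing (Body 𝓡) := .of_surjective' _ (evenToBody_surjective 𝓡)
  have : IsNoetherianRing (Body 𝓡) := isNoetherianRing_body 𝓡
  have hdims : IsRegularLocal 𝓡 ↔
      ringKrullDim (Body 𝓡) = (IsLocalRing.maximalIdeal (Body 𝓡)).spanFinrank ∧
        oddKrullDim 𝓡 = (component 𝓡 1).spanFinrank := by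
    simp only [IsRegularLocal, isLocalWith_iff, exists_eq_left, cotangentDim_zero_eq,
      cotangentDim_one_eq, evenKrullDim, ringKrullDim_even_eq_body]
    rfl
  rw [hdims, isRegularLocalRing_iff, eq_comm, and_congr_right_iff]
  intro hreg
  have : IsRegularLocalRing (Body 𝓡) := (isRegularLocalRing_iff _).2 hreg
  have := isDomain_of_isRegularLocalRing (Body 𝓡)
  exact oddKrullDim_eq_spanFinrank_iff 𝓡

end RegularLocal

section UnitScaling

variable {A : Type u} [Ring A] (𝒜 : ZMod 2 → AddSubgroup A) [GradedRing 𝒜] [SuperCommutative 𝒜]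
  {n : ℕ} {w z : Fin n → component 𝒜 1} {e : Fin n → 𝒜 0}

theorem evenAnn_oddProduct_eq_of_eq_isUnit_smul (he : ∀ i, IsUnit (e i))
    (hw : ∀ i, w i = e i • z i) :
    evenAnn 𝒜 (oddProduct 𝒜 n w) = evenAnn 𝒜 (oddProduct 𝒜 n z) := by
  have hprod : oddProduct 𝒜 n w = (∏ i, e i) • oddProduct 𝒜 n z :=
    (congrArg _ (funext hw)).trans ((oddProduct 𝒜 n).toMultilinearMap.map_smul_univ e z)
  ext c
  change c • oddProduct 𝒜 n w = 0 ↔ c • oddProduct 𝒜 n z = 0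
  rw [hprod, smul_comm]
  exact (IsUnit.prod_univ_iff.2 he).smul_eq_zero

end UnitScaling

section LocalizationTransfer

variable {A : Type u} [Ring A] (𝒜 : ZMod 2 → AddSubgroup A) [GradedRing 𝒜] [SuperCommutative 𝒜]
  (S : Submonoid (𝒜 0))

/-- The localization map `A → S⁻¹A` at a multiplicative set of even elements. -/
noncomputable def locMap : A →ₐ[𝒜 0] LocalizedModule S A :=
  AlgHom.ofLinearMap (LocalizedModule.mkLinearMap S A) OreLocalization.one_def.symm fun a b => by
    simp only [LocalizedModule.mkLinearMap_apply, LocalizedModule.mk_mul_mk, one_mul]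

instance locMap_isLocalizedModule : IsLocalizedModule S (locMap 𝒜 S).toLinearMap :=
  localizedModuleIsLocalizedModule S

variable {𝒜 S} in
theorem locMap_mem_locGrading {i : ZMod 2} {a : A} (ha : a ∈ 𝒜 i) :
    locMap 𝒜 S a ∈ locGrading 𝒜 S i := ⟨a, ha, 1, rfl⟩

noncomputable instance locEvenAlgebra : Algebra (𝒜 0) (locGrading 𝒜 S 0) :=
  RingHom.toAlgebra
    { toFun := fun a => ⟨locMap 𝒜 S a, locMap_mem_locGrading a.2⟩
      map_one' := Subtype.ext (map_one (locMap 𝒜 S))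
      map_mul' := fun a b => Subtype.ext (map_mul (locMap 𝒜 S) (a : A) b)
      map_zero' := Subtype.ext (map_zero (locMap 𝒜 S))
      map_add' := fun a b => Subtype.ext (map_add (locMap 𝒜 S) (a : A) b) }

theorem coe_algebraMap_locGrading (a : 𝒜 0) :
    (algebraMap (𝒜 0) (locGrading 𝒜 S 0) a : LocalizedModule S A) = locMap 𝒜 S a :=
  rfl

instance locEven_isScalarTower :
    IsScalarTower (𝒜 0) (locGrading 𝒜 S 0) (LocalizedModule S A) :=
  ⟨fun r e x => by
    rw [Algebra.smul_def]
    change locMap 𝒜 S r * e * x = r • ((e : LocalizedModule S A) * x)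
    rw [mul_assoc, ← smul_one_mul, ← map_one (locMap 𝒜 S), ← map_smul, even_smul_def, mul_one]⟩

instance locEven_isLocalization : IsLocalization S (locGrading 𝒜 S 0) where
  map_units s := by
    refine IsUnit.of_mul_eq_one ⟨LocalizedModule.mk 1 s, 1, SetLike.GradedOne.one_mem, s, rfl⟩
      (Subtype.ext ?_)
    change LocalizedModule.mk ((s : 𝒜 0) : A) 1 * LocalizedModule.mk 1 s = 1
    rw [LocalizedModule.mk_mul_mk, one_mul, ← even_smul_def]
    exact (LocalizedModule.mk_cancel s 1).trans OreLocalization.one_def.symm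
  surj := by
    rintro ⟨_, a, ha, s, rfl⟩
    refine ⟨(⟨a, ha⟩, s), Subtype.ext ?_⟩
    change LocalizedModule.mk a s * LocalizedModule.mk ((s : 𝒜 0) : A) 1 = LocalizedModule.mk a 1
    rw [LocalizedModule.mk_mul_mk, mul_one, even_comm 𝒜 ha]
    exact LocalizedModule.mk_cancel s a
  exists_of_eq {x y} h := by
    obtain ⟨u, hu⟩ := IsLocalizedModule.exists_of_eq (S := S) (f := (locMap 𝒜 S).toLinearMap)
      (congrArg Subtype.val h)
    exact ⟨u, Subtype.ext hu⟩

/-- The localization map in degree `i`. -/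
noncomputable def locComponentMap (i : ZMod 2) :
    component 𝒜 i →ₗ[𝒜 0] component (locGrading 𝒜 S) i :=
  ((locMap 𝒜 S).toLinearMap.domRestrict (component 𝒜 i)).codRestrict
    ((component (locGrading 𝒜 S) i).restrictScalars (𝒜 0)) fun a => locMap_mem_locGrading a.2

instance locComponentMap_isLocalizedModule (i : ZMod 2) :
    IsLocalizedModule S (locComponentMap 𝒜 S i) where
  map_units s := by
    have := (IsLocalization.map_units (locGrading 𝒜 S 0) s).map
      (Module.toModuleEnd (𝒜 0) (S := locGrading 𝒜 S 0) (component (locGrading 𝒜 S) i))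
    convert this
    ext
    simp
  surj := by
    rintro ⟨_, a, ha, s, rfl⟩
    exact ⟨(⟨a, ha⟩, s), Subtype.ext ((LocalizedModule.smul'_mk _ _ _).trans
      (LocalizedModule.mk_cancel s a))⟩
  exists_of_eq {x y} h := by
    obtain ⟨u, hu⟩ := IsLocalizedModule.exists_of_eq (S := S) (f := (locMap 𝒜 S).toLinearMap)
      (congrArg Subtype.val h)
    exact ⟨u, Subtype.ext hu⟩

variable {𝒜 S}

theorem exists_smul_eq_locMap_of_mem_oddIdeal {x : LocalizedModule S A}
    (hx : x ∈ oddIdeal (locGrading 𝒜 S)) : ∃ t : S, ∃ b ∈ oddIdeal 𝒜, t • x = locMap 𝒜 S b := by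
  induction hx using Submodule.closure_induction with
  | zero => exact ⟨1, 0, zero_mem _, by rw [smul_zero, map_zero]⟩
  | add x y _ _ hx hy =>
    obtain ⟨s, b, hb, hx⟩ := hx
    obtain ⟨t, c, hc, hy⟩ := hy
    refine ⟨s * t, t • b + s • c,
      add_mem (Ideal.mul_mem_left _ _ hb) (Ideal.mul_mem_left _ _ hc), ?_⟩
    rw [smul_add, mul_smul, mul_smul, smul_comm, hx, hy, map_add,
      AlgHom.map_smul_of_tower, AlgHom.map_smul_of_tower]
  | smul_mem r x hx =>
    obtain ⟨a, ha, s, rfl⟩ := hx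
    induction r with
    | _ r t =>
      refine ⟨t * s, r * a, Ideal.mul_mem_left _ _ (odd_mem_oddIdeal 𝒜 ha), ?_⟩
      rw [smul_eq_mul, LocalizedModule.mk_mul_mk]
      exact (LocalizedModule.smul'_mk _ _ _).trans (LocalizedModule.mk_cancel _ _)

theorem locMap_mem_oddIdeal {a : A} (ha : a ∈ oddIdeal 𝒜) :
    locMap 𝒜 S a ∈ oddIdeal (locGrading 𝒜 S) := by
  have h : oddIdeal 𝒜 ≤ (oddIdeal (locGrading 𝒜 S)).comap (locMap 𝒜 S) :=
    Ideal.span_le.2 fun a ha => odd_mem_oddIdeal _ (locMap_mem_locGrading ha)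
  exact h ha

theorem locMap_mem_oddIdeal_iff {a : A} :
    locMap 𝒜 S a ∈ oddIdeal (locGrading 𝒜 S) ↔ ∃ u : S, u • a ∈ oddIdeal 𝒜 := by
  constructor
  · intro h
    obtain ⟨t, b, hb, htb⟩ := exists_smul_eq_locMap_of_mem_oddIdeal h
    rw [← AlgHom.map_smul_of_tower] at htb
    obtain ⟨u, hu⟩ := IsLocalizedModule.exists_of_eq (S := S) (f := (locMap 𝒜 S).toLinearMap) htb
    refine ⟨u * t, ?_⟩
    rw [mul_smul, hu]
    exact Ideal.mul_mem_left _ _ hb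
  · rintro ⟨u, hu⟩
    have h := locMap_mem_oddIdeal (S := S) hu
    rw [AlgHom.map_smul_of_tower, Submonoid.smul_def, ← algebraMap_smul (locGrading 𝒜 S 0)] at h
    exact (((oddIdeal (locGrading 𝒜 S)).restrictScalars (locGrading 𝒜 S 0)).smul_mem_iff_of_isUnit
      (IsLocalization.map_units _ u)).1 h

variable (𝒜 S)

theorem ker_evenToBody_locGrading : RingHom.ker (evenToBody (locGrading 𝒜 S)) =
    (RingHom.ker (evenToBody 𝒜)).map (algebraMap (𝒜 0) (locGrading 𝒜 S 0)) := by
  ext x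
  obtain ⟨c, s, rfl⟩ := IsLocalization.exists_mk'_eq S x
  rw [IsLocalization.mk'_mem_iff, IsLocalization.mk'_mem_iff,
    IsLocalization.algebraMap_mem_map_algebraMap_iff S,
    RingHom.mem_ker, evenToBody_eq_zero_iff, coe_algebraMap_locGrading, locMap_mem_oddIdeal_iff]
  simp only [RingHom.mem_ker, evenToBody_eq_zero_iff]
  exact ⟨fun ⟨u, hu⟩ => ⟨u, u.2, hu⟩, fun ⟨u, hu, h⟩ => ⟨⟨u, hu⟩, h⟩⟩

theorem evenAnn_locMap (x : A) : evenAnn (locGrading 𝒜 S) (locMap 𝒜 S x) =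
    (evenAnn 𝒜 x).map (algebraMap (𝒜 0) (locGrading 𝒜 S 0)) := by
  ext y
  obtain ⟨c, s, rfl⟩ := IsLocalization.exists_mk'_eq S y
  rw [IsLocalization.mk'_mem_iff, IsLocalization.mk'_mem_iff,
    IsLocalization.algebraMap_mem_map_algebraMap_iff S]
  change locMap 𝒜 S c * locMap 𝒜 S x = 0 ↔ ∃ m ∈ S, ((m * c : 𝒜 0) : A) * x = 0
  rw [← map_mul]
  refine (IsLocalizedModule.eq_zero_iff S (locMap 𝒜 S).toLinearMap).trans ?_
  simp only [← even_smul_def, mul_smul]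
  exact ⟨fun ⟨u, hu⟩ => ⟨u, u.2, hu⟩, fun ⟨u, hu, h⟩ => ⟨⟨u, hu⟩, h⟩⟩

theorem oddProduct_locComponentMap {n : ℕ} (a : Fin n → component 𝒜 1) :
    oddProduct (locGrading 𝒜 S) n (locComponentMap 𝒜 S 1 ∘ a) =
      locMap 𝒜 S (oddProduct 𝒜 n a) := by
  rw [oddProduct_apply, oddProduct_apply, map_list_prod, List.map_ofFn]
  rfl

/-- The condition on `A` saying that `S⁻¹A` has free odd generators, namely the images of
`a₁, …, aₙ`. -/
def HasFreeOddGeneratorsAt : Prop :=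
  ∃ (n : ℕ) (a : Fin n → component 𝒜 1),
    (∃ t : S, ∀ x, t • x ∈ Submodule.span (𝒜 0) (Set.range a)) ∧
    ∀ c ∈ evenAnn 𝒜 (oddProduct 𝒜 n a), ∃ u ∈ S, u * c ∈ RingHom.ker (evenToBody 𝒜)

theorem hasFreeOddGenerators_locGrading_iff_exists :
    HasFreeOddGenerators (locGrading 𝒜 S) ↔ ∃ (n : ℕ) (a : Fin n → component 𝒜 1),
      Submodule.span (locGrading 𝒜 S 0) (Set.range (locComponentMap 𝒜 S 1 ∘ a)) = ⊤ ∧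
      evenAnn (locGrading 𝒜 S) (oddProduct (locGrading 𝒜 S) n (locComponentMap 𝒜 S 1 ∘ a)) ≤
        RingHom.ker (evenToBody (locGrading 𝒜 S)) := by
  refine ⟨?_, fun ⟨n, a, h⟩ => ⟨n, _, h⟩⟩
  rintro ⟨n, z, hz, hann⟩
  choose as has using fun i => IsLocalizedModule.surj S (locComponentMap 𝒜 S 1) (z i)
  have hunit (i : Fin n) := IsLocalization.map_units (locGrading 𝒜 S 0) (as i).2
  have hclear (i : Fin n) :=
    (has i).symm.trans (algebraMap_smul (locGrading 𝒜 S 0) ((as i).2 : 𝒜 0) (z i)).symm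
  refine ⟨n, fun i => (as i).1, ?_, ?_⟩
  · rw [← hz]
    exact span_range_eq_of_eq_isUnit_smul hunit hclear
  · rw [← evenAnn_oddProduct_eq_of_eq_isUnit_smul _ hunit hclear] at hann
    exact hann

theorem hasFreeOddGenerators_locGrading_iff [Module.Finite (𝒜 0) (component 𝒜 1)] :
    HasFreeOddGenerators (locGrading 𝒜 S) ↔ HasFreeOddGeneratorsAt 𝒜 S := by
  simp only [hasFreeOddGenerators_locGrading_iff_exists, HasFreeOddGeneratorsAt,
    oddProduct_locComponentMap, evenAnn_locMap, ker_evenToBody_locGrading,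
    Ideal.map_le_iff_le_comap, span_range_comp_eq_top_iff_exists_smul_mem S
      (locGrading 𝒜 S 0)]
  simp only [SetLike.le_def, Ideal.mem_comap,
    IsLocalization.algebraMap_mem_map_algebraMap_iff S]

end LocalizationTransfer

section BodyLocalization

variable {A : Type u} [Ring A] (𝒜 : ZMod 2 → AddSubgroup A) [GradedRing 𝒜] [SuperCommutative 𝒜]

section Submonoid

variable (S : Submonoid (𝒜 0))

noncomputable instance bodyLocAlgebra : Algebra (Body 𝒜) (Body (locGrading 𝒜 S)) :=
  (Ideal.Quotient.lift (oddIdeal 𝒜)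
    ((Ideal.Quotient.mk (oddIdeal (locGrading 𝒜 S))).comp (locMap 𝒜 S : A →+* LocalizedModule S A))
    fun _ ha => Ideal.Quotient.eq_zero_iff_mem.2 (locMap_mem_oddIdeal ha)).toAlgebra

instance body_isLocalization :
    IsLocalization (S.map (evenToBody 𝒜)) (Body (locGrading 𝒜 S)) :=
  IsLocalization.of_surjective S (locGrading 𝒜 S 0) (evenToBody 𝒜) (evenToBody_surjective 𝒜)
    (evenToBody (locGrading 𝒜 S)) (evenToBody_surjective _) (RingHom.ext fun _ => rfl)
    (ker_evenToBody_locGrading 𝒜 S).le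

end Submonoid

variable (P : Ideal (Body 𝒜)) [P.IsPrime]

theorem map_evenCompl_bodyComap :
    (evenCompl 𝒜 (bodyComap 𝒜 P)).map (evenToBody 𝒜) = P.primeCompl := by
  ext b
  constructor
  · rintro ⟨s, hs, rfl⟩
    exact hs
  · intro hb
    obtain ⟨s, rfl⟩ := evenToBody_surjective 𝒜 b
    exact ⟨s, hb, rfl⟩

theorem locEven_isLocalRing :
    IsLocalRing (locGrading 𝒜 (evenCompl 𝒜 (bodyComap 𝒜 P)) 0) := by
  have : IsLocalization.AtPrime (locGrading 𝒜 (evenCompl 𝒜 (bodyComap 𝒜 P)) 0)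
      (P.comap (evenToBody 𝒜)) :=
    locEven_isLocalization 𝒜 (evenCompl 𝒜 (bodyComap 𝒜 P))
  exact IsLocalization.AtPrime.isLocalRing _ (P.comap (evenToBody 𝒜))

theorem isRegularLocalRing_body_localization_iff :
    IsRegularLocalRing (Body (locGrading 𝒜 (evenCompl 𝒜 (bodyComap 𝒜 P)))) ↔
      IsRegularLocalRing (Localization.AtPrime P) := by
  have h := body_isLocalization 𝒜 (evenCompl 𝒜 (bodyComap 𝒜 P))
  rw [map_evenCompl_bodyComap] at h
  let e := IsLocalization.algEquiv P.primeCompl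
    (Body (locGrading 𝒜 (evenCompl 𝒜 (bodyComap 𝒜 P)))) (Localization.AtPrime P)
  exact ⟨fun _ => .of_ringEquiv e.toRingEquiv, fun _ => .of_ringEquiv e.symm.toRingEquiv⟩

variable {𝒜}

theorem isRegularLocal_localization_iff (hA : IsNoetherianSuperRing 𝒜) :
    IsRegularLocal (locGrading 𝒜 (evenCompl 𝒜 (bodyComap 𝒜 P))) ↔
      IsRegularLocalRing (Localization.AtPrime P) ∧
        HasFreeOddGeneratorsAt 𝒜 (evenCompl 𝒜 (bodyComap 𝒜 P)) := by
  have := hA.isNoetherianRing_even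
  have := hA.isNoetherian_component 1
  have := locEven_isLocalRing 𝒜 P
  have : Module.Finite (locGrading 𝒜 (evenCompl 𝒜 (bodyComap 𝒜 P)) 0)
      (component (locGrading 𝒜 (evenCompl 𝒜 (bodyComap 𝒜 P))) 1) :=
    Module.Finite.of_isLocalizedModule (evenCompl 𝒜 (bodyComap 𝒜 P)) (locComponentMap 𝒜 _ 1)
  have : IsNoetherianRing (locGrading 𝒜 (evenCompl 𝒜 (bodyComap 𝒜 P)) 0) :=
    IsLocalization.isNoetherianRing (evenCompl 𝒜 (bodyComap 𝒜 P)) _ inferInstance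
  rw [isRegularLocal_iff, isRegularLocalRing_body_localization_iff,
    hasFreeOddGenerators_locGrading_iff]

theorem isRegular_iff (hA : IsNoetherianSuperRing 𝒜) :
    IsRegular 𝒜 ↔ IsRegularRing (Body 𝒜) ∧ ∀ (P : Ideal (Body 𝒜)) [P.IsPrime],
      HasFreeOddGeneratorsAt 𝒜 (evenCompl 𝒜 (bodyComap 𝒜 P)) := by
  have := hA.isNoetherianRing_even
  have := isNoetherianRing_body 𝒜
  have h : IsRegular 𝒜 ↔ ∀ (P : Ideal (Body 𝒜)) [P.IsPrime],
      IsRegularLocal (locGrading 𝒜 (evenCompl 𝒜 (bodyComap 𝒜 P))) := by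
    refine ⟨fun h P _ => h _, fun h 𝔭 h𝔭 => ?_⟩
    obtain ⟨P, rfl⟩ := exists_eq_bodyComap 𝒜 fun x hx => odd_mem_of_isPrime 𝒜 (𝔭 := 𝔭) hx
    have hP : P.IsPrime := by
      refine ⟨fun hP => h𝔭.ne_top ?_, fun {x y} hxy => ?_⟩
      · rw [hP]
        exact Ideal.comap_top
      · obtain ⟨x, rfl⟩ := Ideal.Quotient.mk_surjective x
        obtain ⟨y, rfl⟩ := Ideal.Quotient.mk_surjective y
        exact h𝔭.mem_or_mem hxy
    exact h P
  rw [h, isRegularRing_iff]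
  simp only [isRegularLocal_localization_iff _ hA]
  exact ⟨fun h => ⟨fun P _ => (h P).1, fun P _ => (h P).2⟩, fun h P _ => ⟨h.1 P, h.2 P⟩⟩

end BodyLocalization

section GradedPieces

variable {A : Type u} [Ring A] (𝒜 : ZMod 2 → AddSubgroup A) [GradedRing 𝒜] [SuperCommutative 𝒜]

theorem oddProduct_mem_oddIdeal_pow {n : ℕ} (v : Fin n → component 𝒜 1) :
    oddProduct 𝒜 n v ∈ oddIdeal 𝒜 ^ n :=
  oddIdeal_pow_eq_span 𝒜 n ▸ Ideal.subset_span ⟨v, rfl⟩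

/-- The map sending an odd element to its class in `I_A / I_A²`. -/
def oddClass : component 𝒜 1 →ₛₗ[evenToBody 𝒜] OddGr 𝒜 1 where
  toFun x := grMk (oddIdeal 𝒜) 1 ⟨x, (Submodule.pow_one (oddIdeal 𝒜)).ge (odd_mem_oddIdeal 𝒜 x.2)⟩
  map_add' _ _ := rfl
  map_smul' _ _ := rfl

theorem oddClass_surjective : Function.Surjective (oddClass 𝒜) := by
  intro m
  obtain ⟨⟨x, hx⟩, rfl⟩ := grMk_surjective (oddIdeal 𝒜) 1 m
  obtain ⟨o, ho, t, ht, rfl⟩ := exists_odd_add_sq 𝒜 ((Submodule.pow_one (oddIdeal 𝒜)).le hx)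
  refine ⟨⟨o, ho⟩, (grMk_eq_iff _).2 ?_⟩
  change o - (o + t) ∈ oddIdeal 𝒜 ^ (1 + 1)
  rw [sub_add_cancel_left]
  exact neg_mem ht

theorem oddClass_eq_zero_iff {x : component 𝒜 1} :
    oddClass 𝒜 x = 0 ↔ (x : A) ∈ oddIdeal 𝒜 ^ 2 :=
  (grMk_eq_iff (oddIdeal 𝒜) (y := 0)).trans (by rw [ZeroMemClass.coe_zero, sub_zero])

theorem finite_oddGr_one [Module.Finite (𝒜 0) (component 𝒜 1)] :
    Module.Finite (Body 𝒜) (OddGr 𝒜 1) :=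
  have : RingHomSurjective (evenToBody 𝒜) := ⟨evenToBody_surjective 𝒜⟩
  Module.Finite.of_surjective (oddClass 𝒜) (oddClass_surjective 𝒜)

theorem lam_ι (m : OddGr 𝒜 1) : lam 𝒜 (ExteriorAlgebra.ι _ m) = grEmbedding 𝒜 m :=
  ExteriorAlgebra.lift_ι_apply _ _ _ _

theorem lam_ιMulti {n : ℕ} (v : Fin n → component 𝒜 1) :
    lam 𝒜 (ExteriorAlgebra.ιMulti (Body 𝒜) n fun i => oddClass 𝒜 (v i)) =
      DirectSum.lof (Body 𝒜) ℕ (OddGr 𝒜) n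
        (grMk (oddIdeal 𝒜) n ⟨oddProduct 𝒜 n v, oddProduct_mem_oddIdeal_pow 𝒜 v⟩) := by
  induction n with
  | zero =>
    rw [ExteriorAlgebra.ιMulti_zero_apply, map_one]
    exact DirectSum.of_eq_of_gradedMonoid_eq (grMk_congr _ rfl _ _ (oddProduct_apply 𝒜 v).symm)
  | succ n ih =>
    have h := ih (Fin.tail v)
    rw [ExteriorAlgebra.ιMulti_succ_apply, map_mul, lam_ι]
    refine (congrArg (_ * ·) h).trans ?_
    change DirectSum.of (OddGr 𝒜) 1 _ * DirectSum.of (OddGr 𝒜) n _ =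
      DirectSum.of (OddGr 𝒜) (n + 1) _
    rw [DirectSum.of_mul_of]
    refine DirectSum.of_eq_of_gradedMonoid_eq (grMk_congr _ (add_comm 1 n) _ _ ?_)
    exact ((congrArg _ (Fin.cons_self_tail v)).symm.trans
      (oddProduct_cons 𝒜 (v 0) (Fin.tail v))).symm

/-- The degree `k` part `⋀ᵏ(I_A / I_A²) → I_Aᵏ / I_Aᵏ⁺¹` of `lam`. -/
noncomputable def gradedLam (k : ℕ) : ⋀[Body 𝒜]^k (OddGr 𝒜 1) →ₗ[Body 𝒜] OddGr 𝒜 k :=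
  DirectSum.component (Body 𝒜) ℕ (OddGr 𝒜) k ∘ₗ (lam 𝒜).toLinearMap.domRestrict _

theorem gradedLam_ιMulti {k : ℕ} (v : Fin k → component 𝒜 1) :
    gradedLam 𝒜 k (exteriorPower.ιMulti (Body 𝒜) k fun i => oddClass 𝒜 (v i)) =
      grMk (oddIdeal 𝒜) k ⟨oddProduct 𝒜 k v, oddProduct_mem_oddIdeal_pow 𝒜 v⟩ :=
  (congrArg (DirectSum.component (Body 𝒜) ℕ (OddGr 𝒜) k) (lam_ιMulti 𝒜 v)).trans
    (DirectSum.component.lof_self _ _ _)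

theorem sum_smul_gradedLam_ιMulti_eq_zero_iff {ι : Type*} [Fintype ι] {k : ℕ}
    (v : ι → Fin k → component 𝒜 1) (c : ι → 𝒜 0) :
    ∑ i, evenToBody 𝒜 (c i) • gradedLam 𝒜 k
        (exteriorPower.ιMulti (Body 𝒜) k fun j => oddClass 𝒜 (v i j)) = 0 ↔
      ∑ i, c i • oddProduct 𝒜 k (v i) ∈ oddIdeal 𝒜 ^ (k + 1) := by
  let p (i : ι) : ↥(oddIdeal 𝒜 ^ k) := ⟨oddProduct 𝒜 k (v i), oddProduct_mem_oddIdeal_pow 𝒜 (v i)⟩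
  have h : ∑ i, evenToBody 𝒜 (c i) • gradedLam 𝒜 k
      (exteriorPower.ιMulti (Body 𝒜) k fun j => oddClass 𝒜 (v i j)) =
      grMk (oddIdeal 𝒜) k (∑ i, (c i : A) • p i) := by
    simp only [gradedLam_ιMulti]
    exact (map_sum (Submodule.mkQ _) (fun i => (c i : A) • p i) Finset.univ).symm
  rw [h]
  refine (grMk_eq_iff (oddIdeal 𝒜) (y := 0)).trans ?_
  rw [AddSubmonoidClass.coe_finsetSum, ZeroMemClass.coe_zero, sub_zero]
  rfl

theorem lam_eq_lof_gradedLam {k : ℕ} (y : ⋀[Body 𝒜]^k (OddGr 𝒜 1)) :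
    lam 𝒜 y = DirectSum.lof (Body 𝒜) ℕ (OddGr 𝒜) k (gradedLam 𝒜 k y) := by
  suffices h : (lam 𝒜).toLinearMap.domRestrict (⋀[Body 𝒜]^k (OddGr 𝒜 1)) =
      DirectSum.lof (Body 𝒜) ℕ (OddGr 𝒜) k ∘ₗ gradedLam 𝒜 k from LinearMap.congr_fun h y
  refine exteriorPower.linearMap_ext (AlternatingMap.ext fun v => ?_)
  choose w hw using fun i => oddClass_surjective 𝒜 (v i)
  obtain rfl : (fun i => oddClass 𝒜 (w i)) = v := funext hw
  exact (lam_ιMulti 𝒜 w).trans (congrArg _ (gradedLam_ιMulti 𝒜 w).symm)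

theorem gradedLam_surjective (k : ℕ) : Function.Surjective (gradedLam 𝒜 k) := by
  suffices h : ∀ x ∈ oddIdeal 𝒜 ^ k, ∃ hx y, gradedLam 𝒜 k y = grMk (oddIdeal 𝒜) k ⟨x, hx⟩ by
    intro z
    obtain ⟨⟨x, hx⟩, rfl⟩ := grMk_surjective (oddIdeal 𝒜) k z
    exact (h x hx).2
  intro x hx
  rw [oddIdeal_pow_eq_span] at hx
  induction hx using Submodule.closure_induction with
  | zero => exact ⟨zero_mem _, 0, map_zero _⟩
  | add x₁ x₂ _ _ h₁ h₂ =>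
    obtain ⟨hx₁, y₁, hy₁⟩ := h₁
    obtain ⟨hx₂, y₂, hy₂⟩ := h₂
    exact ⟨add_mem hx₁ hx₂, y₁ + y₂, by rw [map_add, hy₁, hy₂, ← grMk_add]; rfl⟩
  | smul_mem r x hx =>
    obtain ⟨v, rfl⟩ := hx
    refine ⟨Ideal.mul_mem_left _ r (oddProduct_mem_oddIdeal_pow 𝒜 v),
      Ideal.Quotient.mk (oddIdeal 𝒜) r • exteriorPower.ιMulti (Body 𝒜) k fun i => oddClass 𝒜 (v i),
      ?_⟩
    rw [map_smul, gradedLam_ιMulti, body_smul_mk]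
    rfl

theorem lam_surjective : Function.Surjective (lam 𝒜) := by
  intro y
  induction y using DirectSum.induction_on with
  | zero => exact ⟨0, map_zero _⟩
  | of k x =>
    obtain ⟨z, rfl⟩ := gradedLam_surjective 𝒜 k x
    exact ⟨z, lam_eq_lof_gradedLam 𝒜 z⟩
  | add x y hx hy =>
    obtain ⟨v, rfl⟩ := hx
    obtain ⟨w, rfl⟩ := hy
    exact ⟨v + w, map_add _ _ _⟩

theorem component_lam (x : ExteriorAlgebra (Body 𝒜) (OddGr 𝒜 1)) (k : ℕ) :
    DirectSum.component (Body 𝒜) ℕ (OddGr 𝒜) k (lam 𝒜 x) =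
      gradedLam 𝒜 k (DirectSum.decompose (fun i => ⋀[Body 𝒜]^i (OddGr 𝒜 1)) x k) := by
  induction x using DirectSum.Decomposition.inductionOn
    (fun i => ⋀[Body 𝒜]^i (OddGr 𝒜 1)) with
  | zero => simp only [map_zero, DirectSum.decompose_zero, DirectSum.zero_apply]
  | @homogeneous j y =>
    rw [lam_eq_lof_gradedLam, DirectSum.decompose_coe]
    by_cases hjk : j = k
    · subst hjk
      rw [DirectSum.component.lof_self, DirectSum.of_eq_same]
    · rw [DirectSum.component.of, dif_neg hjk, DirectSum.of_eq_of_ne _ _ _ (Ne.symm hjk), map_zero]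
  | add x y hx hy =>
    rw [map_add, map_add, hx, hy, DirectSum.decompose_add, DirectSum.add_apply, map_add]

theorem lam_injective_iff :
    Function.Injective (lam 𝒜) ↔ ∀ k, Function.Injective (gradedLam 𝒜 k) := by
  simp only [injective_iff_map_eq_zero]
  constructor
  · intro h k y hy
    exact Subtype.ext (h y (by rw [lam_eq_lof_gradedLam, hy, map_zero]))
  · intro h x hx
    refine (DirectSum.decompose (fun i => ⋀[Body 𝒜]^i (OddGr 𝒜 1))).injective ?_
    ext1 k
    rw [DirectSum.decompose_zero, DirectSum.zero_apply]
    exact h k _ (by rw [← component_lam, hx, map_zero])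

end GradedPieces

section OfFreeOddGenerators

variable {A : Type u} [Ring A] {𝒜 : ZMod 2 → AddSubgroup A} [GradedRing 𝒜] [SuperCommutative 𝒜]

theorem oddProduct_append {k l : ℕ} (v : Fin k → component 𝒜 1) (w : Fin l → component 𝒜 1) :
    oddProduct 𝒜 (k + l) (Fin.append v w) = oddProduct 𝒜 k v * oddProduct 𝒜 l w := by
  rw [oddProduct_apply, oddProduct_apply, oddProduct_apply, ← List.prod_append,
    ← List.ofFn_fin_append]
  refine congrArg (fun f => (List.ofFn f).prod) (funext fun i => ?_)
  induction i using Fin.addCases with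
  | left i => rw [Fin.append_left, Fin.append_left]
  | right i => rw [Fin.append_right, Fin.append_right]

theorem oddProduct_comp_mul_oddProduct_comp {n k l : ℕ} (a : Fin n → component 𝒜 1)
    (J : Fin k → Fin n) (J' : Fin l → Fin n) :
    oddProduct 𝒜 k (a ∘ J) * oddProduct 𝒜 l (a ∘ J') =
      oddProduct 𝒜 (k + l) (a ∘ Fin.append J J') := by
  rw [← oddProduct_append]
  refine congrArg _ (funext fun i => ?_)
  induction i using Fin.addCases with
  | left i => simp only [Function.comp_apply, Fin.append_left]
  | right i => simp only [Function.comp_apply, Fin.append_right]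

theorem sum_smul_oddProduct_mul_oddProduct {k l : ℕ} (a : Fin (k + l) → component 𝒜 1)
    (c : (Fin k ↪o Fin (k + l)) → 𝒜 0) {J : Fin k ↪o Fin (k + l)} {J' : Fin l → Fin (k + l)}
    (hJ : Function.Bijective (Fin.append J J')) :
    (∑ K, c K • oddProduct 𝒜 k (a ∘ K)) * oddProduct 𝒜 l (a ∘ J') =
      Equiv.Perm.sign (Equiv.ofBijective _ hJ) • c J • oddProduct 𝒜 (k + l) a := by
  simp only [Finset.sum_mul, smul_mul_assoc, oddProduct_comp_mul_oddProduct_comp]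
  rw [Finset.sum_eq_single J, smul_comm]
  · exact congrArg (c J • ·) ((oddProduct 𝒜 (k + l)).map_perm a (Equiv.ofBijective _ hJ))
  · intro K _ hKJ
    rw [AlternatingMap.map_eq_zero_of_not_injective, smul_zero]
    exact fun h => hKJ (orderEmbedding_eq_of_append_injective hJ h.of_comp)
  · exact fun h => (h (Finset.mem_univ J)).elim

theorem exists_mul_mem_ker_of_sum_mem {S : Submonoid (𝒜 0)} {n : ℕ} {a : Fin n → component 𝒜 1}
    {t : S} (ht : ∀ x, t • x ∈ Submodule.span (𝒜 0) (Set.range a))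
    (hann : ∀ c ∈ evenAnn 𝒜 (oddProduct 𝒜 n a), ∃ u ∈ S, u * c ∈ RingHom.ker (evenToBody 𝒜))
    {k : ℕ} (c : (Fin k ↪o Fin n) → 𝒜 0)
    (hc : ∑ K, c K • oddProduct 𝒜 k (a ∘ K) ∈ oddIdeal 𝒜 ^ (k + 1)) (J : Fin k ↪o Fin n) :
    ∃ u ∈ S, u * c J ∈ RingHom.ker (evenToBody 𝒜) := by
  obtain ⟨l, rfl⟩ := Nat.exists_eq_add_of_le
    (by simpa using Fintype.card_le_of_embedding J.toEmbedding : k ≤ n)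
  obtain ⟨J', hJ⟩ := exists_append_bijective J
  have hmem := mul_mem_pow_add _ hc (oddProduct_mem_oddIdeal_pow 𝒜 (a ∘ J'))
  rw [sum_smul_oddProduct_mul_oddProduct a c hJ] at hmem
  have hzero := pow_smul_eq_zero_of_mem_oddIdeal_pow (by omega) ht hmem
  rw [smul_comm, smul_eq_zero_iff_eq, ← mul_smul] at hzero
  obtain ⟨u, hu, huc⟩ := hann _ hzero
  exact ⟨u * (t : 𝒜 0) ^ (k + 1 + l), mul_mem hu (pow_mem t.2 _), by rwa [mul_assoc]⟩

theorem evenToBody_smul_mem_span_oddClass {n : ℕ} {a : Fin n → component 𝒜 1} {t : 𝒜 0}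
    (ht : ∀ x, t • x ∈ Submodule.span (𝒜 0) (Set.range a)) (m : OddGr 𝒜 1) :
    evenToBody 𝒜 t • m ∈ Submodule.span (Body 𝒜) (Set.range (oddClass 𝒜 ∘ a)) := by
  have : RingHomSurjective (evenToBody 𝒜) := ⟨evenToBody_surjective 𝒜⟩
  obtain ⟨x, rfl⟩ := oddClass_surjective 𝒜 m
  rw [Set.range_comp, ← Submodule.map_span, ← map_smulₛₗ]
  exact Submodule.mem_map_of_mem (ht x)

theorem HasFreeOddGeneratorsAt.exists_ιMulti {S : Submonoid (𝒜 0)}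
    (h : HasFreeOddGeneratorsAt 𝒜 S) (k : ℕ) :
    ∃ (n : ℕ) (e : (Fin k ↪o Fin n) → ⋀[Body 𝒜]^k (OddGr 𝒜 1)),
      (∃ t : S.map (evenToBody 𝒜), ∀ y, t • y ∈ Submodule.span (Body 𝒜) (Set.range e)) ∧
      ∀ c : (Fin k ↪o Fin n) → Body 𝒜, ∑ J, c J • gradedLam 𝒜 k (e J) = 0 →
        ∀ J, ∃ u ∈ S.map (evenToBody 𝒜), u * c J = 0 := by
  obtain ⟨n, a, ⟨t, ht⟩, hann⟩ := h
  refine ⟨n, fun J => exteriorPower.ιMulti (Body 𝒜) k ((oddClass 𝒜 ∘ a) ∘ J),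
    ⟨⟨evenToBody 𝒜 t, Submonoid.mem_map_of_mem _ t.2⟩ ^ k,
      pow_smul_mem_span_ιMulti_orderEmbedding (evenToBody_smul_mem_span_oddClass ht)⟩,
    fun c hc J => ?_⟩
  obtain ⟨c, rfl⟩ := (evenToBody_surjective 𝒜).comp_left c
  obtain ⟨u, hu, huc⟩ := exists_mul_mem_ker_of_sum_mem ht hann c
    ((sum_smul_gradedLam_ιMulti_eq_zero_iff 𝒜 (fun J : Fin k ↪o Fin n => a ∘ J) c).1 hc) J
  exact ⟨_, Submonoid.mem_map_of_mem _ hu, (map_mul _ _ _).symm.trans huc⟩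

theorem HasFreeOddGeneratorsAt.localizedModule_map_gradedLam_injective {S : Submonoid (𝒜 0)}
    (h : HasFreeOddGeneratorsAt 𝒜 S) (k : ℕ) :
    Function.Injective (LocalizedModule.map (S.map (evenToBody 𝒜)) (gradedLam 𝒜 k)) := by
  obtain ⟨n, e, ⟨t, ht⟩, hindep⟩ := h.exists_ιMulti k
  exact localizedModule_map_injective_of_forall_smul_mem ht hindep

theorem HasFreeOddGeneratorsAt.projective_localizedModule {S : Submonoid (𝒜 0)}
    (h : HasFreeOddGeneratorsAt 𝒜 S) : Module.Projective (Localization (S.map (evenToBody 𝒜)))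
      (LocalizedModule (S.map (evenToBody 𝒜)) (OddGr 𝒜 1)) := by
  obtain ⟨n, e, ⟨t, ht⟩, hindep⟩ := h.exists_ιMulti 1
  refine projective_localizedModule_of_forall_smul_mem (a := gradedLam 𝒜 1 ∘ e) (t := t)
    (fun m => ?_) hindep
  obtain ⟨y, rfl⟩ := gradedLam_surjective 𝒜 1 m
  rw [Set.range_comp, ← Submodule.map_span]
  exact ⟨_, ht y, map_smul _ (t : Body 𝒜) _⟩

theorem gradedLam_injective_of_hasFreeOddGeneratorsAt
    (h : ∀ (P : Ideal (Body 𝒜)) [P.IsPrime],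
      HasFreeOddGeneratorsAt 𝒜 (evenCompl 𝒜 (bodyComap 𝒜 P))) (k : ℕ) :
    Function.Injective (gradedLam 𝒜 k) := by
  refine injective_of_localized_maximal _ fun P hP => ?_
  have := hP.isPrime
  exact map_evenCompl_bodyComap 𝒜 P ▸ (h P).localizedModule_map_gradedLam_injective k

theorem projective_of_hasFreeOddGeneratorsAt [IsNoetherianRing (Body 𝒜)]
    [Module.Finite (Body 𝒜) (OddGr 𝒜 1)]
    (h : ∀ (P : Ideal (Body 𝒜)) [P.IsPrime],
      HasFreeOddGeneratorsAt 𝒜 (evenCompl 𝒜 (bodyComap 𝒜 P))) :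
    Module.Projective (Body 𝒜) (OddGr 𝒜 1) := by
  have := Module.finitePresentation_of_finite (Body 𝒜) (OddGr 𝒜 1)
  refine Module.projective_of_localization_maximal fun P hP => ?_
  have := hP.isPrime
  have hproj := (h P).projective_localizedModule
  rwa [map_evenCompl_bodyComap] at hproj

end OfFreeOddGenerators

section OfProjective

variable {A : Type u} [Ring A] {𝒜 : ZMod 2 → AddSubgroup A} [GradedRing 𝒜] [SuperCommutative 𝒜]

theorem ker_oddClass_le :
    LinearMap.ker (oddClass 𝒜) ≤
      RingHom.ker (evenToBody 𝒜) • (⊤ : Submodule (𝒜 0) (component 𝒜 1)) := fun _ hx =>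
  (odd_mem_bodyComap_sq_iff 𝒜 (P := ⊥)).1
    (Ideal.pow_right_mono (oddIdeal_le_bodyComap 𝒜 ⊥) 2 ((oddClass_eq_zero_iff 𝒜).1 hx))

theorem exists_pow_smul_mem_span_of_evenToBody_smul_mem_span [IsNoetherianRing (𝒜 0)]
    [Module.Finite (𝒜 0) (component 𝒜 1)] {n : ℕ} {a : Fin n → component 𝒜 1} {t : 𝒜 0}
    (ht : ∀ m, evenToBody 𝒜 t • m ∈ Submodule.span (Body 𝒜) (Set.range (oddClass 𝒜 ∘ a))) :
    ∃ k, ∀ x, t ^ k • x ∈ Submodule.span (𝒜 0) (Set.range a) := by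
  have : RingHomSurjective (evenToBody 𝒜) := ⟨evenToBody_surjective 𝒜⟩
  obtain ⟨k, hk⟩ := (Ideal.FG.isNilpotent_iff_le_nilradical
    (Ideal.fg_of_isNoetherianRing _)).2 (ker_evenToBody_le_nilradical 𝒜)
  have hle : Ideal.span {t} • (⊤ : Submodule (𝒜 0) (component 𝒜 1)) ≤
      Submodule.span (𝒜 0) (Set.range a) ⊔ RingHom.ker (evenToBody 𝒜) • ⊤ := by
    refine le_trans ?_ (sup_le_sup_left ker_oddClass_le _)
    rw [← Submodule.comap_map_eq, Submodule.map_span, ← Set.range_comp, Submodule.smul_le]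
    intro r hr x _
    obtain ⟨s, rfl⟩ := Ideal.mem_span_singleton'.1 hr
    rw [mul_smul]
    refine Submodule.smul_mem _ s ?_
    rw [Submodule.mem_comap, map_smulₛₗ]
    exact ht _
  have hpow := pow_smul_le_sup_pow_smul hle k
  rw [hk, Ideal.zero_eq_bot, Submodule.bot_smul, sup_bot_eq] at hpow
  exact ⟨k, fun x => hpow (Submodule.smul_mem_smul
    (Ideal.pow_mem_pow (Ideal.mem_span_singleton_self t) k) Submodule.mem_top)⟩

theorem hasFreeOddGeneratorsAt_of_projective [IsNoetherianRing (𝒜 0)]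
    [Module.Finite (𝒜 0) (component 𝒜 1)] [Module.Projective (Body 𝒜) (OddGr 𝒜 1)]
    (hinj : ∀ k, Function.Injective (gradedLam 𝒜 k)) (P : Ideal (Body 𝒜)) [P.IsPrime] :
    HasFreeOddGeneratorsAt 𝒜 (evenCompl 𝒜 (bodyComap 𝒜 P)) := by
  have := finite_oddGr_one 𝒜
  obtain ⟨n, m, b, hb⟩ := exists_basis_localizedModule (M := OddGr 𝒜 1) P
  obtain ⟨a, rfl⟩ := (oddClass_surjective 𝒜).comp_left m
  obtain ⟨⟨t, htP⟩, ht⟩ := (span_range_comp_eq_top_iff_exists_smul_mem P.primeCompl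
    (Localization.AtPrime P) (LocalizedModule.mkLinearMap P.primeCompl (OddGr 𝒜 1))).1
      (hb ▸ b.span_eq)
  rw [← map_evenCompl_bodyComap] at htP
  obtain ⟨s, hs, rfl⟩ := htP
  obtain ⟨k, hk⟩ := exists_pow_smul_mem_span_of_evenToBody_smul_mem_span ht
  refine ⟨n, a, ⟨⟨s ^ k, pow_mem hs k⟩, hk⟩, fun c hc => ?_⟩
  have hwedge : evenToBody 𝒜 c • exteriorPower.ιMulti (Body 𝒜) n (oddClass 𝒜 ∘ a) = 0 := by
    refine hinj n ?_
    rw [map_smul, map_zero]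
    have h := (sum_smul_gradedLam_ιMulti_eq_zero_iff 𝒜 (fun _ : Unit => a) fun _ => c).2
    rw [Fintype.sum_unique, Fintype.sum_unique] at h
    have hc : c • oddProduct 𝒜 n a = 0 := hc
    exact h (hc ▸ zero_mem _)
  obtain ⟨u, hu, huc⟩ := exists_mul_eq_zero_of_smul_ιMulti_eq_zero P.primeCompl _ b hb hwedge
  rw [← map_evenCompl_bodyComap] at hu
  obtain ⟨u, hu, rfl⟩ := hu
  exact ⟨u, hu, (map_mul _ _ _).trans huc⟩

end OfProjective

end SuperRing

theorem mainTheorem3 {A : Type u} [Ring A] (𝒜 : ZMod 2 → AddSubgroup A) [GradedRing 𝒜]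
    [SuperCommutative 𝒜] (hA : SuperRing.IsNoetherianSuperRing 𝒜) :
    SuperRing.IsRegular 𝒜 ↔
      IsRegularRing (SuperRing.Body 𝒜) ∧
      Module.Projective (SuperRing.Body 𝒜) (SuperRing.OddGr 𝒜 1) ∧
      Function.Bijective (SuperRing.lam 𝒜) := by
  have := hA.isNoetherianRing_even
  have := hA.isNoetherian_component 1
  have := SuperRing.isNoetherianRing_body 𝒜
  have := SuperRing.finite_oddGr_one 𝒜
  rw [SuperRing.isRegular_iff hA, and_congr_right_iff]
  intro _
  constructor
  · intro h
    exact ⟨SuperRing.projective_of_hasFreeOddGeneratorsAt h,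
      (SuperRing.lam_injective_iff 𝒜).2 (SuperRing.gradedLam_injective_of_hasFreeOddGeneratorsAt h),
      SuperRing.lam_surjective 𝒜⟩
  · rintro ⟨_, hinj, _⟩ P _
    exact SuperRing.hasFreeOddGeneratorsAt_of_projective ((SuperRing.lam_injective_iff 𝒜).1 hinj) P
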